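/- An instance $I$ of the reward-penalty-selection problem (RPSP) consists of a set of players $N=\{1,\dots,n\}$, reward sets $A_1,\dots,A_h\subseteq N$ with rewards $a_1,\dots,a_h\ge 0$, and penalty sets $B_1,\dots,B_l\subseteq N$ with penalties $b_1,\dots,b_l\ge 0$. The decision problem of the max-RPSP asks, for $I$ and a number $\alpha$, whether there is a set $X\subseteq N$ with $$\sum_{i:\,A_i\subseteq X} a_i-\sum_{j:\,B_j\cap X\ne\emptyset} b_j\;\ge\;\alpha .$$ Let $G(I)$ be the directed network with vertices $s,t,B_1,\dots,B_l,A_1,\dots,A_h$ whose arcs are $(s,B_j)$ with capacity $b_j$ for all $j$, $(A_i,t)$ with capacity $a_i$ for all $i$, and $(B_j,A_i)$ with capacity $\infty$ whenever $A_i\cap B_j\neq\emptyset$. Theorem (max-RPSP). The decision problem of the max-RPSP is polynomially solvable, by a minimum cut computation. More precisely: 1. For every instance $I$ with real rewards and penalties and every $\alpha\in\mathbb R$, the answer for $(I,\alpha)$ is yes if and only if there is a minimum $s$-$t$ cut of $G(I)$ whose capacity is at most $\sum_{i=1}^h a_i-\alpha$. 2. The network $G(I)$ and the number $\sum_{i=1}^h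 a_i-\alpha$ can be computed from $(I,\alpha)$ in polynomial time. 3. The decision problem of the max-RPSP can be solved in polynomial time. Here an algorithm is a program for a random access machine that adds, subtracts and compares numbers and natural-number indices, and the instance is given by $n,h,l$, the incidence matrices of the set systems, and the numbers $a_i,b_j,\alpha$. In 2 and in 3, one and the same program runs in polynomial time in both usual senses: on all instances with real numbers its number of steps is at most a polynomial in $n+h+l$, and on all instances with rational numbers its number of bit operations (every operation being charged the binary length of the numbers it handles) is at most a polynomial in $n+h+l$ plus the total binary length of the numbers $a_i,b_j,\alpha$. -/

import Mathlib

/-! ### Instances of the reward-penalty-selection problem -/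

/-- An instance with players `Fin n`, reward sets `A i` with rewards `a i ≥ 0` and penalty sets
`B j` with penalties `b j ≥ 0`; the numbers are taken from `R`. -/
structure RPSP (R : Type) [AddCommGroup R] [LinearOrder R] where
  /-- number of players -/
  n : ℕ
  /-- number of reward sets -/
  h : ℕ
  /-- number of penalty sets -/
  l : ℕ
  /-- reward sets -/
  A : Fin h → Finset (Fin n)
  /-- rewards -/
  a : Fin h → R
  /-- penalty sets -/
  B : Fin l → Finset (Fin n)
  /-- penalties -/
  b : Fin l → R
  a_nonneg : ∀ i, 0 ≤ a i
  b_nonneg : ∀ j, 0 ≤ b j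

namespace RPSP

variable {R : Type} [AddCommGroup R] [LinearOrder R]

/-- The objective function: rewards of the covered reward sets minus penalties of the hit
penalty sets. -/
def profit (I : RPSP R) (X : Finset (Fin I.n)) : R :=
  (∑ i with I.A i ⊆ X, I.a i) - ∑ j with (I.B j ∩ X).Nonempty, I.b j

/-- The decision problem of the max-RPSP. -/
def MaxDecision (I : RPSP R) (α : R) : Prop :=
  ∃ X : Finset (Fin I.n), α ≤ I.profit X

end RPSP

/-! ### Networks and minimum `s`-`t` cuts -/

/-- A directed network on the vertex set `V` with capacities in `R ∪ {∞}`; a pair of capacity `0`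
is a non-arc. -/
structure FlowNetwork (R V : Type) where
  /-- source -/
  s : V
  /-- sink -/
  t : V
  /-- capacity of the arc from the first to the second vertex -/
  cap : V → V → WithTop R

namespace FlowNetwork

variable {R V : Type} [AddCommGroup R] [LinearOrder R] [Fintype V] [DecidableEq V]

/-- `(S, V \ S)` is an `s`-`t` cut. -/
def IsCut (N : FlowNetwork R V) (S : Finset V) : Prop := N.s ∈ S ∧ N.t ∉ S

/-- Total capacity of the arcs leaving `S`. -/
def cutCapacity (N : FlowNetwork R V) (S : Finset V) : WithTop R :=
  ∑ u ∈ S, ∑ v ∈ Sᶜ, N.cap u v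

/-- `(S, V \ S)` is an `s`-`t` cut of minimum capacity. -/
def IsMinCut (N : FlowNetwork R V) (S : Finset V) : Prop :=
  N.IsCut S ∧ ∀ S' : Finset V, N.IsCut S' → N.cutCapacity S ≤ N.cutCapacity S'

end FlowNetwork

/-- Vertices of the reward-penalty-selection network with `h` reward and `l` penalty sets. -/
inductive RPNode (h l : ℕ) : Type
  | source : RPNode h l
  | sink : RPNode h l
  | penalty (j : Fin l) : RPNode h l
  | reward (i : Fin h) : RPNode h l
  deriving DecidableEq, Fintype

/-- The numbering of the vertices by `0, …, h + l + 1`. -/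
def RPNode.code {h l : ℕ} : RPNode h l → ℕ
  | .source => 0
  | .sink => 1
  | .penalty j => 2 + j
  | .reward i => 2 + l + i

namespace RPSP

variable {R : Type} [AddCommGroup R] [LinearOrder R]

/-- The bipartite reward-penalty-selection network. Its arcs are `(s, B j)` with capacity `b j`,
`(A i, t)` with capacity `a i`, and `(B j, A i)` with capacity `∞` whenever `A i` and `B j`
intersect. -/
def network (I : RPSP R) : FlowNetwork R (RPNode I.h I.l) where
  s := .source
  t := .sink
  cap
    | .source, .penalty j => (I.b j : WithTop R)
    | .reward i, .sink => (I.a i : WithTop R)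
    | .penalty j, .reward i => if (I.A i ∩ I.B j).Nonempty then ⊤ else 0
    | _, _ => 0

end RPSP

/-! ### A random access machine over numbers from `R`

Programs work on two-dimensional arrays of natural numbers (used for indices and bits) and on
two-dimensional arrays of numbers from `R`; a program names finitely many arrays. Addresses are
computed (indirect addressing). The only arithmetic is addition, subtraction and comparison;
in particular there is no multiplication. -/

namespace RAM

/-- Memory: `idx k` and `num k` are the `k`-th array of naturals and of numbers. -/
@[ext]
structure Store (R : Type) where
  /-- arrays of natural numbers -/
  idx : ℕ → ℕ → ℕ → ℕ
  /-- arrays of numbers -/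
  num : ℕ → ℕ → ℕ → R

/-- Expressions for natural numbers; `cell k e f` is the entry `[e, f]` of the array `k`, and `sub`
is truncated subtraction. -/
inductive IExpr : Type
  | lit (c : ℕ) : IExpr
  | cell (k : ℕ) (e f : IExpr) : IExpr
  | add (e f : IExpr) : IExpr
  | sub (e f : IExpr) : IExpr

/-- Expressions for numbers. -/
inductive NExpr : Type
  | zero : NExpr
  | cell (k : ℕ) (e f : IExpr) : NExpr
  | add (x y : NExpr) : NExpr
  | sub (x y : NExpr) : NExpr

/-- Tests. -/
inductive Test : Type
  | lt (e f : IExpr) : Test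
  | le (x y : NExpr) : Test
  | not (c : Test) : Test
  | and (c d : Test) : Test

/-- Programs. -/
inductive Prog : Type
  | skip : Prog
  | setIdx (k : ℕ) (e f v : IExpr) : Prog
  | setNum (k : ℕ) (e f : IExpr) (v : NExpr) : Prog
  | seq (P Q : Prog) : Prog
  | ite (c : Test) (P Q : Prog) : Prog
  | while (c : Test) (P : Prog) : Prog

/-- What is charged for handling a natural number and for handling a number. -/
structure CostModel (R : Type) where
  /-- charge for a natural number -/
  idx : ℕ → ℕ
  /-- charge for a number -/
  num : R → ℕ

/-- Unit cost: every operation takes one step. -/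
def unitCost (R : Type) : CostModel R where
  idx _ := 1
  num _ := 1

/-- Bit cost (logarithmic cost) for rational numbers: every operation is charged the binary length
of what it handles. -/
def bitCost : CostModel ℚ where
  idx k := 1 + Nat.size k
  num q := 1 + Nat.size q.num.natAbs + Nat.size q.den

section Semantics

variable {R : Type} [AddCommGroup R] [LinearOrder R]

/-- Value of an index expression. -/
def IExpr.eval (σ : Store R) : IExpr → ℕ
  | .lit c => c
  | .cell k e f => σ.idx k (e.eval σ) (f.eval σ)
  | .add e f => e.eval σ + f.eval σ
  | .sub e f => e.eval σ - f.eval σ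

/-- Cost of evaluating an index expression: the charges of all values that occur. -/
def IExpr.cost (M : CostModel R) (σ : Store R) : IExpr → ℕ
  | .lit c => M.idx c
  | .cell k e f => e.cost M σ + f.cost M σ + M.idx (σ.idx k (e.eval σ) (f.eval σ))
  | .add e f => e.cost M σ + f.cost M σ + M.idx (e.eval σ + f.eval σ)
  | .sub e f => e.cost M σ + f.cost M σ + M.idx (e.eval σ - f.eval σ)

/-- Value of a number expression. -/
def NExpr.eval (σ : Store R) : NExpr → R
  | .zero => 0
  | .cell k e f => σ.num k (e.eval σ) (f.eval σ)
  | .add x y => x.eval σ + y.eval σ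
  | .sub x y => x.eval σ - y.eval σ

/-- Cost of evaluating a number expression. -/
def NExpr.cost (M : CostModel R) (σ : Store R) : NExpr → ℕ
  | .zero => M.num 0
  | .cell k e f => e.cost M σ + f.cost M σ + M.num (σ.num k (e.eval σ) (f.eval σ))
  | .add x y => x.cost M σ + y.cost M σ + M.num (x.eval σ + y.eval σ)
  | .sub x y => x.cost M σ + y.cost M σ + M.num (x.eval σ - y.eval σ)

/-- Truth of a test. -/
def Test.Holds (σ : Store R) : Test → Prop
  | .lt e f => e.eval σ < f.eval σ
  | .le x y => x.eval σ ≤ y.eval σ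
  | .not c => ¬ c.Holds σ
  | .and c d => c.Holds σ ∧ d.Holds σ

/-- Cost of a test. -/
def Test.cost (M : CostModel R) (σ : Store R) : Test → ℕ
  | .lt e f => e.cost M σ + f.cost M σ + 1
  | .le x y => x.cost M σ + y.cost M σ + 1
  | .not c => c.cost M σ + 1
  | .and c d => c.cost M σ + d.cost M σ + 1

/-- Overwriting one entry of an array of naturals. -/
def Store.setIdx (σ : Store R) (k i j v : ℕ) : Store R where
  idx k' i' j' := if k' = k ∧ i' = i ∧ j' = j then v else σ.idx k' i' j'
  num := σ.num

/-- Overwriting one entry of an array of numbers. -/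
def Store.setNum (σ : Store R) (k i j : ℕ) (v : R) : Store R where
  idx := σ.idx
  num k' i' j' := if k' = k ∧ i' = i ∧ j' = j then v else σ.num k' i' j'

/-- `Exec M P σ T σ'`: started in `σ`, the program `P` halts in `σ'` after time `T`, measured in the
cost model `M`. -/
inductive Exec (M : CostModel R) : Prog → Store R → ℕ → Store R → Prop
  | skip (σ : Store R) : Exec M .skip σ 1 σ
  | setIdx (σ : Store R) (k : ℕ) (e f v : IExpr) :
      Exec M (.setIdx k e f v) σ (e.cost M σ + f.cost M σ + v.cost M σ + 1)
        (σ.setIdx k (e.eval σ) (f.eval σ) (v.eval σ))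
  | setNum (σ : Store R) (k : ℕ) (e f : IExpr) (v : NExpr) :
      Exec M (.setNum k e f v) σ (e.cost M σ + f.cost M σ + v.cost M σ + 1)
        (σ.setNum k (e.eval σ) (f.eval σ) (v.eval σ))
  | seq {P Q : Prog} {σ σ' σ'' : Store R} {T T' : ℕ} :
      Exec M P σ T σ' → Exec M Q σ' T' σ'' → Exec M (.seq P Q) σ (T + T') σ''
  | iteTrue {c : Test} {P Q : Prog} {σ σ' : Store R} {T : ℕ} :
      c.Holds σ → Exec M P σ T σ' → Exec M (.ite c P Q) σ (c.cost M σ + T) σ'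
  | iteFalse {c : Test} {P Q : Prog} {σ σ' : Store R} {T : ℕ} :
      ¬ c.Holds σ → Exec M Q σ T σ' → Exec M (.ite c P Q) σ (c.cost M σ + T) σ'
  | whileTrue {c : Test} {P : Prog} {σ σ' σ'' : Store R} {T T' : ℕ} :
      c.Holds σ → Exec M P σ T σ' → Exec M (.while c P) σ' T' σ'' →
        Exec M (.while c P) σ (c.cost M σ + T + T') σ''
  | whileFalse {c : Test} {P : Prog} {σ : Store R} :
      ¬ c.Holds σ → Exec M (.while c P) σ (c.cost M σ) σ

/-- Programs are deterministic: the final store and the running time are determined by the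
initial store. -/
theorem Exec.deterministic {M : CostModel R} {P : Prog} {σ σ₁ σ₂ : Store R} {T₁ T₂ : ℕ}
    (h₁ : Exec M P σ T₁ σ₁) (h₂ : Exec M P σ T₂ σ₂) : T₁ = T₂ ∧ σ₁ = σ₂ := by
  induction h₁ generalizing T₂ σ₂ with
  | skip σ => cases h₂; exact ⟨rfl, rfl⟩
  | setIdx => cases h₂; exact ⟨rfl, rfl⟩
  | setNum => cases h₂; exact ⟨rfl, rfl⟩
  | seq _ _ ih ih' =>
    cases h₂ with
    | seq a b =>
      obtain ⟨rfl, rfl⟩ := ih a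
      obtain ⟨rfl, rfl⟩ := ih' b
      exact ⟨rfl, rfl⟩
  | iteTrue hc _ ih =>
    cases h₂ with
    | iteTrue _ a => obtain ⟨rfl, rfl⟩ := ih a; exact ⟨rfl, rfl⟩
    | iteFalse hc' _ => exact absurd hc hc'
  | iteFalse hc _ ih =>
    cases h₂ with
    | iteTrue hc' _ => exact absurd hc' hc
    | iteFalse _ a => obtain ⟨rfl, rfl⟩ := ih a; exact ⟨rfl, rfl⟩
  | whileTrue hc _ _ ih ih' =>
    cases h₂ with
    | whileTrue _ a b =>
      obtain ⟨rfl, rfl⟩ := ih a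
      obtain ⟨rfl, rfl⟩ := ih' b
      exact ⟨rfl, rfl⟩
    | whileFalse hc' => exact absurd hc hc'
  | whileFalse hc =>
    cases h₂ with
    | whileTrue hc' _ _ => exact absurd hc' hc
    | whileFalse _ => exact ⟨rfl, rfl⟩

end Semantics

end RAM

/-! ### Deciding the max-RPSP, and reducing it to a minimum cut, in polynomial time -/

namespace RPSP

variable {R : Type} [AddCommGroup R] [LinearOrder R]

/-- The initial store for the instance `I` with threshold `α`: `n, h, l` in row `0` of the index
array `0`, the incidence matrices of the reward and of the penalty sets in the index arrays `1` and
`2`, the rewards, the penalties and `α` in row `0` of the number arrays `0`, `1` and `2`, and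
zeros elsewhere. -/
def input (I : RPSP R) (α : R) : RAM.Store R where
  idx
    | 0, 0, 0 => I.n
    | 0, 0, 1 => I.h
    | 0, 0, 2 => I.l
    | 1, i, u => if ∃ (hi : i < I.h) (hu : u < I.n), ⟨u, hu⟩ ∈ I.A ⟨i, hi⟩ then 1 else 0
    | 2, j, u => if ∃ (hj : j < I.l) (hu : u < I.n), ⟨u, hu⟩ ∈ I.B ⟨j, hj⟩ then 1 else 0
    | _, _, _ => 0
  num
    | 0, 0, i => if hi : i < I.h then I.a ⟨i, hi⟩ else 0
    | 1, 0, j => if hj : j < I.l then I.b ⟨j, hj⟩ else 0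
    | 2, 0, 0 => α
    | _, _, _ => 0

/-- The size of the input in a cost model. For unit cost this counts players, sets and numbers;
for bit cost the numbers contribute their binary lengths. -/
def inputSize (M : RAM.CostModel R) (I : RPSP R) (α : R) : ℕ :=
  I.n + I.h + I.l + ∑ i, M.num (I.a i) + ∑ j, M.num (I.b j) + M.num α

/-- In time bounded by a polynomial in the input size, `P` halts on every instance and every
threshold, with entry `[0, 0]` of the index array `3` equal to `1` on yes-instances and to `0` on
no-instances. -/
def DecidedInPolyTime (M : RAM.CostModel R) (P : RAM.Prog) : Prop :=
  ∃ p : Polynomial ℕ, ∀ (I : RPSP R) (α : R), ∃ (T : ℕ) (σ : RAM.Store R),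
    RAM.Exec M P (I.input α) T σ ∧ T ≤ p.eval (inputSize M I α) ∧
    (I.MaxDecision α → σ.idx 3 0 0 = 1) ∧ (¬ I.MaxDecision α → σ.idx 3 0 0 = 0)

/-- The threshold with which the capacity of a minimum cut has to be compared. -/
def cutThreshold (I : RPSP R) (α : R) : R := (∑ i, I.a i) - α

open Classical in
/-- The store holds the network of `I` (number of vertices, positions of the infinite capacities,
values of the finite capacities) and the threshold for its minimum cut. -/
def HoldsNetwork (I : RPSP R) (α : R) (σ : RAM.Store R) : Prop :=
  σ.idx 3 0 0 = I.h + I.l + 2 ∧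
  (∀ u v, σ.idx 4 u.code v.code = if I.network.cap u v = ⊤ then 1 else 0) ∧
  (∀ u v, σ.num 3 u.code v.code = (I.network.cap u v).untopD 0) ∧
  σ.num 4 0 0 = I.cutThreshold α

/-- In time bounded by a polynomial in the input size, `P` turns every instance into its network
and threshold. -/
def NetworkBuiltInPolyTime (M : RAM.CostModel R) (P : RAM.Prog) : Prop :=
  ∃ p : Polynomial ℕ, ∀ (I : RPSP R) (α : R), ∃ (T : ℕ) (σ : RAM.Store R),
    RAM.Exec M P (I.input α) T σ ∧ T ≤ p.eval (inputSize M I α) ∧ I.HoldsNetwork α σ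

end RPSP

/-! The profit of `X` is the total reward minus its loss, the loss being the penalties of the sets
hit plus the rewards of the sets not covered. So the question is whether some loss is at most
`cutThreshold`. Put the penalty sets missed by `X` and the reward sets not covered by `X` on the
source side. No infinite arc is cut, because a reward set inside `X` shares no player with a set
that misses `X`, and the finite arcs cut add up to the loss. Conversely, a cut of finite capacity
costs at least the loss of the selection of all players that lie in no penalty set of the source
side. This is `exists_pair_of_selection`, `exists_selection_of_pair` and `cutCapacity_eq`, which
give `maxDecision_iff_minCut`.

A minimum cut value is computed by preflow pushing, which only adds, subtracts and compares. The
source arcs become initial excesses of the penalty vertices, and the sum of all penalties replaces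
`∞`, which does not change the answer (`Built.maxDecision_iff`). Excess moves to lower labels until
it reaches the sink or sits at labels at least `N`. A gap in the labels then exhibits a cut whose
value is the excess of the sink (`Inv.exists_cut`), while that excess never exceeds any cut value
(`Inv.excess_le`). A lexicographic potential bounds the number of steps by a polynomial in the
number of vertices alone (`potential_le`).

All this holds in unit cost over every linearly ordered abelian group, hence over `ℝ` and over `ℚ`.
Over `ℚ`, `T` additions and subtractions with a fixed common denominator lengthen the numerators by
at most `T` bits, so polynomially many steps have polynomial bit cost (`Exec.bitCost_le`). -/

/-! ### From unit cost to bit cost -/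

namespace RAM

/-- The largest literal in an index expression. -/
def IExpr.maxLit : IExpr → ℕ
  | .lit c => c
  | .cell _ e f => max e.maxLit f.maxLit
  | .add e f => max e.maxLit f.maxLit
  | .sub e f => max e.maxLit f.maxLit

/-- The largest literal in a number expression. -/
def NExpr.maxLit : NExpr → ℕ
  | .zero => 0
  | .cell _ e f => max e.maxLit f.maxLit
  | .add x y => max x.maxLit y.maxLit
  | .sub x y => max x.maxLit y.maxLit

/-- The largest literal in a test. -/
def Test.maxLit : Test → ℕ
  | .lt e f => max e.maxLit f.maxLit
  | .le x y => max x.maxLit y.maxLit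
  | .not c => c.maxLit
  | .and c d => max c.maxLit d.maxLit

/-- The largest literal in a program. -/
def Prog.maxLit : Prog → ℕ
  | .skip => 0
  | .setIdx _ e f v => max (max e.maxLit f.maxLit) v.maxLit
  | .setNum _ e f v => max (max e.maxLit f.maxLit) v.maxLit
  | .seq P Q => max P.maxLit Q.maxLit
  | .ite c P Q => max c.maxLit (max P.maxLit Q.maxLit)
  | .while c P => max c.maxLit P.maxLit

/-- `x` is a fraction with denominator `D` and a numerator of absolute value at most `2 ^ K`. -/
def HasSize (D K : ℕ) (x : ℚ) : Prop := ∃ z : ℤ, x * D = z ∧ z.natAbs ≤ 2 ^ K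

theorem HasSize.mono {D K L : ℕ} {x : ℚ} (hx : HasSize D K x) (h : K ≤ L) : HasSize D L x := by
  obtain ⟨z, h1, h2⟩ := hx
  exact ⟨z, h1, h2.trans (Nat.pow_le_pow_right two_pos h)⟩

/-- If `a` and `b` are the unit costs of two operands, `a + b + 1` is that of their sum. Thus an
expression gains at most as many bits as it takes steps. -/
theorem two_pow_add_two_pow_le {K a b : ℕ} : 2 ^ (K + a) + 2 ^ (K + b) ≤ 2 ^ (K + (a + b + 1)) := by
  have h1 : 2 ^ (K + a) ≤ 2 ^ (K + (a + b)) := Nat.pow_le_pow_right two_pos (by omega)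
  have h2 : 2 ^ (K + b) ≤ 2 ^ (K + (a + b)) := Nat.pow_le_pow_right two_pos (by omega)
  have h3 : 2 ^ (K + (a + b + 1)) = 2 * 2 ^ (K + (a + b)) := by ring
  omega

theorem hasSize_zero (D K : ℕ) : HasSize D K 0 := ⟨0, by simp, by simp⟩

theorem HasSize.add {D K a b : ℕ} {x y : ℚ} (hx : HasSize D (K + a) x) (hy : HasSize D (K + b) y) :
    HasSize D (K + (a + b + 1)) (x + y) := by
  obtain ⟨z, h1, h2⟩ := hx
  obtain ⟨w, h3, h4⟩ := hy
  refine ⟨z + w, by push_cast; rw [add_mul, h1, h3], ?_⟩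
  exact (Int.natAbs_add_le z w).trans ((add_le_add h2 h4).trans two_pow_add_two_pow_le)

theorem HasSize.sub {D K a b : ℕ} {x y : ℚ} (hx : HasSize D (K + a) x) (hy : HasSize D (K + b) y) :
    HasSize D (K + (a + b + 1)) (x - y) := by
  obtain ⟨z, h1, h2⟩ := hx
  obtain ⟨w, h3, h4⟩ := hy
  refine ⟨z - w, by push_cast; rw [sub_mul, h1, h3], ?_⟩
  exact (Int.natAbs_sub_le z w).trans ((add_le_add h2 h4).trans two_pow_add_two_pow_le)

theorem size_le_of_le_two_pow {m k : ℕ} (h : m ≤ 2 ^ k) : Nat.size m ≤ k + 1 := by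
  rw [Nat.size_le]
  exact h.trans_lt (Nat.pow_lt_pow_right one_lt_two (Nat.lt_succ_self k))

/-- Reducing the fraction `z / D` makes neither part longer: the reduced denominator divides `D`,
and the numerator shrinks accordingly. Each part then has at most `K + 1` bits. -/
theorem HasSize.charge_le {D K : ℕ} {x : ℚ} (hD : 0 < D) (hDK : D ≤ 2 ^ K) (hx : HasSize D K x) :
    bitCost.num x ≤ 2 * K + 3 := by
  obtain ⟨z, h1, h2⟩ := hx
  have hmul : x.num * D = z * x.den := by
    have h3 : (x.num : ℚ) * D = z * x.den := by
      rw [← h1, ← Rat.mul_den_eq_num x]; ring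
    exact_mod_cast h3
  have hdvd : x.den ∣ D := by
    have h4 : (x.den : ℤ) ∣ x.num * D := ⟨z, by rw [hmul]; ring⟩
    have h5 : IsCoprime (x.den : ℤ) x.num := by
      rw [Int.isCoprime_iff_gcd_eq_one, Int.gcd_comm]; exact x.reduced
    exact_mod_cast h5.dvd_of_dvd_mul_left h4
  have hden : x.den ≤ D := Nat.le_of_dvd hD hdvd
  have hnum : x.num.natAbs ≤ z.natAbs := by
    have h6 : x.num.natAbs * D = z.natAbs * x.den := by
      have := congrArg Int.natAbs hmul
      simpa [Int.natAbs_mul] using this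
    by_contra! hlt
    have := Nat.mul_lt_mul_of_lt_of_le hlt hden hD
    omega
  have h7 := size_le_of_le_two_pow (hnum.trans h2)
  have h8 := size_le_of_le_two_pow (hden.trans hDK)
  simp only [bitCost]
  omega

theorem bitCost_idx_le {m k : ℕ} (h : m ≤ 2 ^ k) : bitCost.idx m ≤ 2 * k + 3 := by
  have := size_le_of_le_two_pow h
  simp only [bitCost]
  omega

/-- All entries of the store have size at most `K`, with the common denominator `D`. -/
structure Store.Bounded (D K : ℕ) (σ : Store ℚ) : Prop where
  idx : ∀ k i j, σ.idx k i j ≤ 2 ^ K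
  num : ∀ k i j, HasSize D K (σ.num k i j)

theorem Store.Bounded.mono {D K L : ℕ} {σ : Store ℚ} (hσ : σ.Bounded D K) (h : K ≤ L) :
    σ.Bounded D L :=
  ⟨fun k i j => (hσ.idx k i j).trans (Nat.pow_le_pow_right two_pos h),
    fun k i j => (hσ.num k i j).mono h⟩

/-- The bound `a * (2 * (K + a) + 3)` charges each of `a` steps for a number of `K + a` bits. It is
superadditive in `a`, so it passes from operands to the compound expression, whose own charge is
`z`. -/
theorem charge_add_le {K a b x y z : ℕ} (hx : x ≤ a * (2 * (K + a) + 3))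
    (hy : y ≤ b * (2 * (K + b) + 3)) (hz : z ≤ 2 * (K + (a + b + 1)) + 3) :
    x + y + z ≤ (a + b + 1) * (2 * (K + (a + b + 1)) + 3) := by
  have h1 : a * (2 * (K + a) + 3) ≤ a * (2 * (K + (a + b + 1)) + 3) := by gcongr; omega
  have h2 : b * (2 * (K + b) + 3) ≤ b * (2 * (K + (a + b + 1)) + 3) := by gcongr; omega
  linarith

theorem charge_mono {K a b : ℕ} (h : a ≤ b) :
    a * (2 * (K + a) + 3) ≤ a * (2 * (K + b) + 3) := by gcongr

theorem IExpr.bitCost_le {D K : ℕ} {σ : Store ℚ} (hσ : σ.Bounded D K) (e : IExpr)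
    (he : e.maxLit ≤ 2 ^ K) :
    e.eval σ ≤ 2 ^ (K + e.cost (unitCost ℚ) σ) ∧
      e.cost bitCost σ ≤ e.cost (unitCost ℚ) σ * (2 * (K + e.cost (unitCost ℚ) σ) + 3) := by
  have up : ∀ {m a : ℕ}, m ≤ 2 ^ K → m ≤ 2 ^ (K + a) := fun h =>
    h.trans (Nat.pow_le_pow_right two_pos (Nat.le_add_right _ _))
  induction e with
  | lit c =>
    refine ⟨up he, ?_⟩
    simpa [IExpr.cost, unitCost, IExpr.maxLit] using bitCost_idx_le (k := K + 1) (up he)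
  | cell k e f ihe ihf =>
    obtain ⟨he1, he2⟩ := ihe ((le_max_left _ _).trans he)
    obtain ⟨hf1, hf2⟩ := ihf ((le_max_right _ _).trans he)
    exact ⟨up (hσ.idx _ _ _), charge_add_le he2 hf2 (bitCost_idx_le (up (hσ.idx _ _ _)))⟩
  | add e f ihe ihf =>
    obtain ⟨he1, he2⟩ := ihe ((le_max_left _ _).trans he)
    obtain ⟨hf1, hf2⟩ := ihf ((le_max_right _ _).trans he)
    have := (add_le_add he1 hf1).trans two_pow_add_two_pow_le
    exact ⟨this, charge_add_le he2 hf2 (bitCost_idx_le this)⟩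
  | sub e f ihe ihf =>
    obtain ⟨he1, he2⟩ := ihe ((le_max_left _ _).trans he)
    obtain ⟨hf1, hf2⟩ := ihf ((le_max_right _ _).trans he)
    have := (Nat.sub_le _ (f.eval σ)).trans (((Nat.le_add_right _ _).trans
      (add_le_add he1 hf1)).trans two_pow_add_two_pow_le)
    exact ⟨this, charge_add_le he2 hf2 (bitCost_idx_le this)⟩

theorem NExpr.bitCost_le {D K : ℕ} {σ : Store ℚ} (hD : 0 < D) (hDK : D ≤ 2 ^ K)
    (hσ : σ.Bounded D K) (x : NExpr) (hx : x.maxLit ≤ 2 ^ K) :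
    HasSize D (K + x.cost (unitCost ℚ) σ) (x.eval σ) ∧
      x.cost bitCost σ ≤ x.cost (unitCost ℚ) σ * (2 * (K + x.cost (unitCost ℚ) σ) + 3) := by
  have up : ∀ {m a : ℕ}, m ≤ 2 ^ K → m ≤ 2 ^ (K + a) := fun h =>
    h.trans (Nat.pow_le_pow_right two_pos (Nat.le_add_right _ _))
  induction x with
  | zero =>
    refine ⟨hasSize_zero _ _, ?_⟩
    simpa [NExpr.cost, unitCost] using (hasSize_zero D (K + 1)).charge_le hD (up hDK)
  | cell k e f =>
    obtain ⟨he1, he2⟩ := e.bitCost_le hσ ((le_max_left _ _).trans hx)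
    obtain ⟨hf1, hf2⟩ := f.bitCost_le hσ ((le_max_right _ _).trans hx)
    have := (hσ.num k (e.eval σ) (f.eval σ)).mono (Nat.le_add_right K
      (e.cost (unitCost ℚ) σ + f.cost (unitCost ℚ) σ + 1))
    exact ⟨this, charge_add_le he2 hf2 (this.charge_le hD (up hDK))⟩
  | add e f ihe ihf =>
    obtain ⟨he1, he2⟩ := ihe ((le_max_left _ _).trans hx)
    obtain ⟨hf1, hf2⟩ := ihf ((le_max_right _ _).trans hx)
    have := he1.add hf1
    exact ⟨this, charge_add_le he2 hf2 (this.charge_le hD (up hDK))⟩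
  | sub e f ihe ihf =>
    obtain ⟨he1, he2⟩ := ihe ((le_max_left _ _).trans hx)
    obtain ⟨hf1, hf2⟩ := ihf ((le_max_right _ _).trans hx)
    have := he1.sub hf1
    exact ⟨this, charge_add_le he2 hf2 (this.charge_le hD (up hDK))⟩

theorem Test.bitCost_le {D K : ℕ} {σ : Store ℚ} (hD : 0 < D) (hDK : D ≤ 2 ^ K)
    (hσ : σ.Bounded D K) (c : Test) (hc : c.maxLit ≤ 2 ^ K) :
    c.cost bitCost σ ≤ c.cost (unitCost ℚ) σ * (2 * (K + c.cost (unitCost ℚ) σ) + 3) := by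
  induction c with
  | lt e f =>
    exact charge_add_le (e.bitCost_le hσ ((le_max_left _ _).trans hc)).2
      (f.bitCost_le hσ ((le_max_right _ _).trans hc)).2 (by omega)
  | le x y =>
    exact charge_add_le (x.bitCost_le hD hDK hσ ((le_max_left _ _).trans hc)).2
      (y.bitCost_le hD hDK hσ ((le_max_right _ _).trans hc)).2 (by omega)
  | not c ih =>
    exact charge_add_le (b := 0) (y := 0) (z := 1) (ih hc) (by simp) (by omega)
  | and c d ihc ihd =>
    exact charge_add_le (ihc ((le_max_left _ _).trans hc)) (ihd ((le_max_right _ _).trans hc))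
      (by omega)

theorem charge_seq_le {K a b x y : ℕ} (hx : x ≤ a * (2 * (K + a) + 3))
    (hy : y ≤ b * (2 * (K + a + b) + 3)) : x + y ≤ (a + b) * (2 * (K + (a + b)) + 3) := by
  have h1 : a * (2 * (K + a) + 3) ≤ a * (2 * (K + (a + b)) + 3) := charge_mono (by omega)
  have h2 : K + a + b = K + (a + b) := by omega
  rw [h2] at hy
  linarith

/-- A run that takes `T` steps from a store of size `K` has bit cost `O(T (K + T))`, since numbers
are only added and subtracted. -/
theorem Exec.bitCost_le {D K T : ℕ} {P : Prog} {σ σ' : Store ℚ} (hD : 0 < D)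
    (h : Exec (unitCost ℚ) P σ T σ') (hDK : D ≤ 2 ^ K) (hσ : σ.Bounded D K)
    (hP : P.maxLit ≤ 2 ^ K) :
    σ'.Bounded D (K + T) ∧ ∃ T', Exec bitCost P σ T' σ' ∧ T' ≤ T * (2 * (K + T) + 3) := by
  have up : ∀ {m K a : ℕ}, m ≤ 2 ^ K → m ≤ 2 ^ (K + a) := fun h =>
    h.trans (Nat.pow_le_pow_right two_pos (Nat.le_add_right _ _))
  -- The second of two consecutive runs starts in a store that has already grown by the time of the
  -- first, so `K` has to vary.
  induction h generalizing K with
  | skip σ => exact ⟨hσ.mono (Nat.le_add_right _ _), _, .skip σ, by omega⟩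
  | setIdx σ k e f v =>
    simp only [Prog.maxLit, max_le_iff] at hP
    obtain ⟨he1, he2⟩ := e.bitCost_le hσ hP.1.1
    obtain ⟨hf1, hf2⟩ := f.bitCost_le hσ hP.1.2
    obtain ⟨hv1, hv2⟩ := v.bitCost_le hσ hP.2
    refine ⟨⟨fun k' i j => ?_, fun k' i j => (hσ.num k' i j).mono (Nat.le_add_right _ _)⟩, _,
      .setIdx σ k e f v, ?_⟩
    · simp only [Store.setIdx]
      split_ifs
      · exact hv1.trans (Nat.pow_le_pow_right two_pos (by omega))
      · exact up (hσ.idx _ _ _)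
    · have := charge_seq_le he2 (hf2.trans (Nat.mul_le_mul_left _ (by omega)))
      exact charge_add_le this hv2 (by omega)
  | setNum σ k e f v =>
    simp only [Prog.maxLit, max_le_iff] at hP
    obtain ⟨he1, he2⟩ := e.bitCost_le hσ hP.1.1
    obtain ⟨hf1, hf2⟩ := f.bitCost_le hσ hP.1.2
    obtain ⟨hv1, hv2⟩ := v.bitCost_le hD hDK hσ hP.2
    refine ⟨⟨fun k' i j => up (hσ.idx k' i j), fun k' i j => ?_⟩, _, .setNum σ k e f v, ?_⟩
    · simp only [Store.setNum]
      split_ifs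
      · exact hv1.mono (by omega)
      · exact (hσ.num _ _ _).mono (Nat.le_add_right _ _)
    · have := charge_seq_le he2 (hf2.trans (Nat.mul_le_mul_left _ (by omega)))
      exact charge_add_le this hv2 (by omega)
  | seq h1 h2 ih1 ih2 =>
    simp only [Prog.maxLit, max_le_iff] at hP
    obtain ⟨b1, T1, e1, c1⟩ := ih1 hDK hσ hP.1
    obtain ⟨b2, T2, e2, c2⟩ := ih2 (up hDK) b1 (up hP.2)
    exact ⟨b2.mono (by omega), _, .seq e1 e2, charge_seq_le c1 c2⟩
  | iteTrue hc h1 ih1 =>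
    simp only [Prog.maxLit, max_le_iff] at hP
    obtain ⟨b1, T1, e1, c1⟩ := ih1 hDK hσ hP.2.1
    exact ⟨b1.mono (by omega), _, .iteTrue hc e1, charge_seq_le
      (Test.bitCost_le hD hDK hσ _ hP.1) (c1.trans (Nat.mul_le_mul_left _ (by omega)))⟩
  | iteFalse hc h1 ih1 =>
    simp only [Prog.maxLit, max_le_iff] at hP
    obtain ⟨b1, T1, e1, c1⟩ := ih1 hDK hσ hP.2.2
    exact ⟨b1.mono (by omega), _, .iteFalse hc e1, charge_seq_le
      (Test.bitCost_le hD hDK hσ _ hP.1) (c1.trans (Nat.mul_le_mul_left _ (by omega)))⟩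
  | whileTrue hc h1 h2 ih1 ih2 =>
    have hP' := hP
    simp only [Prog.maxLit, max_le_iff] at hP
    obtain ⟨b1, T1, e1, c1⟩ := ih1 hDK hσ hP.2
    obtain ⟨b2, T2, e2, c2⟩ := ih2 (up hDK) b1 (up hP')
    have h3 := charge_seq_le (Test.bitCost_le hD hDK hσ _ hP.1)
      (c1.trans (Nat.mul_le_mul_left _ (by omega)))
    exact ⟨b2.mono (by omega), _, .whileTrue hc e1 e2, charge_seq_le h3
      (c2.trans (Nat.mul_le_mul_left _ (by omega)))⟩
  | whileFalse hc =>
    simp only [Prog.maxLit, max_le_iff] at hP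
    exact ⟨hσ.mono (by omega), _, .whileFalse hc, Test.bitCost_le hD hDK hσ _ hP.1⟩

end RAM

/-! ### Binary size of rational instances. -/

namespace RPSP

theorem eval_monotone (p : Polynomial ℕ) : Monotone fun x => p.eval x := by
  intro x y hxy
  simp only [Polynomial.eval_eq_sum, Polynomial.sum]
  gcongr

theorem unit_inputSize_le (I : RPSP ℚ) (α : ℚ) :
    inputSize (RAM.unitCost ℚ) I α ≤ inputSize RAM.bitCost I α := by
  have h : ∀ q : ℚ, (RAM.unitCost ℚ).num q ≤ RAM.bitCost.num q := fun q => by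
    simp only [RAM.unitCost, RAM.bitCost]; omega
  unfold inputSize
  gcongr <;> apply h

/-- A common denominator of the numbers of an instance. -/
def commonDen (I : RPSP ℚ) (α : ℚ) : ℕ :=
  (∏ i, (I.a i).den) * (∏ j, (I.b j).den) * α.den

theorem commonDen_pos (I : RPSP ℚ) (α : ℚ) : 0 < commonDen I α :=
  Nat.mul_pos (Nat.mul_pos (Finset.prod_pos fun i _ => (I.a i).den_pos)
    (Finset.prod_pos fun j _ => (I.b j).den_pos)) α.den_pos

theorem den_le_two_pow (q : ℚ) : q.den ≤ 2 ^ Nat.size q.den := (Nat.lt_size_self _).le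

theorem prod_den_le {ι : Type} (s : Finset ι) (f : ι → ℚ) :
    ∏ i ∈ s, (f i).den ≤ 2 ^ ∑ i ∈ s, Nat.size (f i).den := by
  rw [← Finset.prod_pow_eq_pow_sum]
  exact Finset.prod_le_prod' fun i _ => den_le_two_pow _

theorem commonDen_le (I : RPSP ℚ) (α : ℚ) :
    commonDen I α ≤ 2 ^ (∑ i, Nat.size (I.a i).den + ∑ j, Nat.size (I.b j).den
      + Nat.size α.den) := by
  rw [pow_add, pow_add]
  exact Nat.mul_le_mul (Nat.mul_le_mul (prod_den_le _ _) (prod_den_le _ _)) (den_le_two_pow _)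

theorem hasSize_of_dvd {D K : ℕ} {q : ℚ} (hdvd : q.den ∣ D)
    (hK : q.num.natAbs * D ≤ 2 ^ K) : RAM.HasSize D K q := by
  obtain ⟨m, rfl⟩ := hdvd
  refine ⟨q.num * m, by push_cast; rw [← mul_assoc, Rat.mul_den_eq_num], ?_⟩
  rw [Int.natAbs_mul, Int.natAbs_natCast]
  refine le_trans ?_ hK
  gcongr
  exact Nat.le_mul_of_pos_left _ q.den_pos

/-- Over the common denominator, a numerator is at most as long as the original numerator together
with all denominators. Both are covered by the bit size of the input, which counts numerators and
denominators separately. -/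
theorem bounded_input (I : RPSP ℚ) (α : ℚ) :
    (I.input α).Bounded (commonDen I α) (inputSize RAM.bitCost I α) := by
  have hsize : ∀ q : ℚ, q.num.natAbs ≤ 2 ^ Nat.size q.num.natAbs := fun q =>
    (Nat.lt_size_self _).le
  have key : ∀ q : ℚ, q.den ∣ commonDen I α → Nat.size q.num.natAbs ≤
      ∑ i, Nat.size (I.a i).num.natAbs + ∑ j, Nat.size (I.b j).num.natAbs + Nat.size α.num.natAbs →
      RAM.HasSize (commonDen I α) (inputSize RAM.bitCost I α) q := by
    intro q h1 h2
    refine hasSize_of_dvd h1 ((Nat.mul_le_mul (hsize q) (commonDen_le I α)).trans ?_)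
    rw [← pow_add]
    refine Nat.pow_le_pow_right two_pos ?_
    simp only [inputSize, RAM.bitCost, Finset.sum_add_distrib]
    omega
  have hbig : ∀ m : ℕ, m ≤ inputSize RAM.bitCost I α → m ≤ 2 ^ inputSize RAM.bitCost I α :=
    fun m h => (h.trans_lt Nat.lt_two_pow_self).le
  have h1 : 1 ≤ 2 ^ inputSize RAM.bitCost I α := Nat.one_le_two_pow
  constructor
  · intro k i j
    unfold input
    dsimp only
    split
    · exact hbig _ (by unfold inputSize; omega)
    · exact hbig _ (by unfold inputSize; omega)
    · exact hbig _ (by unfold inputSize; omega)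
    · split_ifs <;> omega
    · split_ifs <;> omega
    · omega
  · intro k i j
    unfold input
    dsimp only
    split
    · split_ifs with hi
      · refine key _ ?_ ?_
        · exact Dvd.dvd.mul_right (Dvd.dvd.mul_right
            (Finset.dvd_prod_of_mem (fun i => (I.a i).den) (Finset.mem_univ _)) _) _
        · have := Finset.single_le_sum (f := fun i => Nat.size (I.a i).num.natAbs)
            (fun _ _ => Nat.zero_le _) (Finset.mem_univ ⟨j, hi⟩)
          omega
      · exact RAM.hasSize_zero _ _
    · split_ifs with hi
      · refine key _ ?_ ?_
        · exact Dvd.dvd.mul_right (Dvd.dvd.mul_left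
            (Finset.dvd_prod_of_mem (fun i => (I.b i).den) (Finset.mem_univ _)) _) _
        · have := Finset.single_le_sum (f := fun i => Nat.size (I.b i).num.natAbs)
            (fun _ _ => Nat.zero_le _) (Finset.mem_univ ⟨j, hi⟩)
          omega
      · exact RAM.hasSize_zero _ _
    · exact key _ (Dvd.intro_left _ rfl) (by omega)
    · exact RAM.hasSize_zero _ _

/-- Polynomially many steps on rational instances take polynomial bit cost. -/
theorem bitCost_of_unitCost {P : RAM.Prog} {Q : RPSP ℚ → ℚ → RAM.Store ℚ → Prop}
    (h : ∃ p : Polynomial ℕ, ∀ (I : RPSP ℚ) (α : ℚ), ∃ (T : ℕ) (σ : RAM.Store ℚ),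
      RAM.Exec (RAM.unitCost ℚ) P (I.input α) T σ ∧
        T ≤ p.eval (inputSize (RAM.unitCost ℚ) I α) ∧ Q I α σ) :
    ∃ p : Polynomial ℕ, ∀ (I : RPSP ℚ) (α : ℚ), ∃ (T : ℕ) (σ : RAM.Store ℚ),
      RAM.Exec RAM.bitCost P (I.input α) T σ ∧
        T ≤ p.eval (inputSize RAM.bitCost I α) ∧ Q I α σ := by
  obtain ⟨p, hp⟩ := h
  -- This is the bound `T * (2 * (K + T) + 3)` with `T` at most `p` and `K` the input size plus
  -- `P.maxLit`; the latter makes room for the literals of the program.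
  refine ⟨p * (2 * (Polynomial.X + Polynomial.C P.maxLit + p) + 3), fun I α => ?_⟩
  obtain ⟨T, σ, he, hT, hQ⟩ := hp I α
  have hT' := hT.trans (eval_monotone p (unit_inputSize_le I α))
  simp only at hT'
  set s := inputSize RAM.bitCost I α with hs
  have hden : commonDen I α ≤ 2 ^ (s + P.maxLit) := by
    refine (commonDen_le I α).trans (Nat.pow_le_pow_right two_pos ?_)
    simp only [hs, inputSize, RAM.bitCost, Finset.sum_add_distrib]
    omega
  have hlit : P.maxLit ≤ 2 ^ (s + P.maxLit) :=
    Nat.lt_two_pow_self.le.trans (Nat.pow_le_pow_right two_pos (Nat.le_add_left _ _))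
  obtain ⟨-, T', he', hT''⟩ := he.bitCost_le (commonDen_pos I α) hden
    ((bounded_input I α).mono (Nat.le_add_right _ _)) hlit
  refine ⟨T', σ, he', hT''.trans ?_, hQ⟩
  simp only [Polynomial.eval_mul, Polynomial.eval_add, Polynomial.eval_X, Polynomial.eval_C,
    Polynomial.eval_ofNat]
  gcongr

end RPSP

/-! ### Minimum cuts by preflow pushing -/

namespace Preflow

variable {R : Type} [AddCommGroup R] [LinearOrder R]

/-- The invariant of preflow pushing on the vertices `0, …, N - 1` with sink `1`, supplies `q` and
capacities `c`: residual capacities `r`, excesses `e`, labels `d`, current arcs `p` and current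
vertex `u`. The vertices `0` and `1` keep the label `0`. -/
structure Inv (N : ℕ) (q : ℕ → R) (c r : ℕ → ℕ → R) (e : ℕ → R) (d p : ℕ → ℕ) (u : ℕ) : Prop where
  r_nonneg : ∀ v w, 0 ≤ r v w
  r_add : ∀ v w, r v w + r w v = c v w + c w v
  e_nonneg : ∀ w, 0 ≤ e w
  e_eq : ∀ w < N, e w = q w + ∑ v ∈ Finset.range N, (c v w - r v w)
  e_zero : e 0 = 0
  r_zero : ∀ w, r w 0 = 0
  d_zero : d 0 = 0
  d_one : d 1 = 0
  valid : ∀ v < N, ∀ w < N, 0 < r v w → d v ≤ d w + 1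
  p_le : ∀ w, p w ≤ N
  scanned : ∀ v < N, ∀ w < p v, 0 < r v w → d v ≤ d w
  done : ∀ w, 2 ≤ w → w < u → 0 < e w → N ≤ d w
  two_le : 2 ≤ u
  u_le : u ≤ N

/-- The arc from `v` to `w` is admissible. -/
def Admissible (r : ℕ → ℕ → R) (d : ℕ → ℕ) (x : ℕ × ℕ) : Prop := 0 < r x.1 x.2 ∧ d x.2 < d x.1

/-- The vertex `w` is active. -/
def Active (N : ℕ) (e : ℕ → R) (d : ℕ → ℕ) (w : ℕ) : Prop := 2 ≤ w ∧ 0 < e w ∧ d w < N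

/-- How far the labels are from `N`. -/
def slack (N : ℕ) (d : ℕ → ℕ) : ℕ := ∑ w ∈ Finset.range N, (N - d w)

open Classical in
/-- The number of admissible arcs. -/
noncomputable def numAdmissible (N : ℕ) (r : ℕ → ℕ → R) (d : ℕ → ℕ) : ℕ :=
  ((Finset.range N ×ˢ Finset.range N).filter (Admissible r d)).card

open Classical in
/-- The sum of the labels of the active vertices. -/
noncomputable def activeLabels (N : ℕ) (e : ℕ → R) (d : ℕ → ℕ) : ℕ :=
  ∑ w ∈ Finset.range N, if Active N e d w then d w else 0

/-- The potential that decreases in each step of preflow pushing. -/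
noncomputable def potential (N : ℕ) (r : ℕ → ℕ → R) (e : ℕ → R) (d p : ℕ → ℕ) (u : ℕ) : ℕ :=
  (((slack N d * (N * N + 1) + numAdmissible N r d) * (N * N + 1) + activeLabels N e d)
    * (N * N + 1) + slack N p) * (N * N + 1) + (N - u)

theorem slack_le (N : ℕ) (d : ℕ → ℕ) : slack N d ≤ N * N := by
  have := Finset.sum_le_card_nsmul (Finset.range N) (fun w => N - d w) N (fun w _ => Nat.sub_le _ _)
  simpa [slack] using this

theorem numAdmissible_le (N : ℕ) (r : ℕ → ℕ → R) (d : ℕ → ℕ) : numAdmissible N r d ≤ N * N := by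
  classical
  refine (Finset.card_filter_le _ _).trans ?_
  simp

theorem activeLabels_le (N : ℕ) (e : ℕ → R) (d : ℕ → ℕ) : activeLabels N e d ≤ N * N := by
  classical
  have := Finset.sum_le_card_nsmul (Finset.range N)
    (fun w => if Active N e d w then d w else 0) N (fun w _ => by
      split_ifs with h
      · exact h.2.2.le
      · omega)
  simpa [activeLabels] using this

theorem lex_lt {K a a' b b' : ℕ} (h : a' < a) (hb : b' < K) : a' * K + b' < a * K + b := by
  have : (a' + 1) * K ≤ a * K := Nat.mul_le_mul_right K h
  linarith

theorem lex_lt_right {K a a' b b' : ℕ} (h : a' ≤ a) (hb : b' < b) : a' * K + b' < a * K + b := by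
  have : a' * K ≤ a * K := Nat.mul_le_mul_right K h
  linarith

theorem lex_lt_of_le {K a a' b b' : ℕ} (h : a' < a ∨ a' ≤ a ∧ b' < b) (hb : b' < K) :
    a' * K + b' < a * K + b := by
  rcases h with h | ⟨h, h'⟩
  · exact lex_lt h hb
  · exact lex_lt_right h h'

/-- The potential is a number with five digits in base `N * N + 1`. -/
theorem potential_le (N : ℕ) (r : ℕ → ℕ → R) (e : ℕ → R) (d p : ℕ → ℕ) (u : ℕ) :
    potential N r e d p u ≤ (N * N + 1) ^ 5 := by
  have h1 := slack_le N d
  have h2 := numAdmissible_le N r d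
  have h3 := activeLabels_le N e d
  have h4 := slack_le N p
  have h5 : N - u < N * N + 1 := by
    have := Nat.le_mul_self N
    omega
  have key : ∀ {a b K n : ℕ}, a < K ^ n → b < K → a * K + b < K ^ (n + 1) := by
    intro a b K n h h'
    have : (a + 1) * K ≤ K ^ n * K := Nat.mul_le_mul_right K h
    rw [pow_succ]
    linarith
  unfold potential
  refine (key (key (key (key (n := 1) ?_ ?_) ?_) ?_) h5).le <;> (try rw [pow_one]) <;> omega

/-- A lexicographic decrease of the digits suffices. The leading digit falls in a relabelling, the
second in a saturating push, the third in any other push (where the second may fall too), the fourth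
when a current arc advances, and the last when the current vertex advances. -/
theorem potential_lt {N : ℕ} {r r' : ℕ → ℕ → R} {e e' : ℕ → R} {d d' p p' : ℕ → ℕ} {u u' : ℕ}
    (h : slack N d' < slack N d ∨ slack N d' ≤ slack N d ∧
      (numAdmissible N r' d' < numAdmissible N r d ∨ numAdmissible N r' d' ≤ numAdmissible N r d ∧
      (activeLabels N e' d' < activeLabels N e d ∨ activeLabels N e' d' ≤ activeLabels N e d ∧
      (slack N p' < slack N p ∨ slack N p' ≤ slack N p ∧ N - u' < N - u)))) :
    potential N r' e' d' p' u' < potential N r e d p u := by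
  have h2 := numAdmissible_le N r' d'
  have h3 := activeLabels_le N e' d'
  have h4 := slack_le N p'
  have h5 : N - u' < N * N + 1 := by
    have := Nat.le_mul_self N
    omega
  have mono : ∀ {a a' b b' K : ℕ}, a' ≤ a → b' ≤ b → a' * K + b' ≤ a * K + b :=
    fun h h' => Nat.add_le_add (Nat.mul_le_mul_right _ h) h'
  unfold potential
  refine lex_lt_of_le ?_ h5
  rcases h with h | ⟨h, h'⟩
  · exact .inl (lex_lt (lex_lt (lex_lt h (by omega)) (by omega)) (by omega))
  rcases h' with h' | ⟨h', h''⟩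
  · exact .inl (lex_lt (lex_lt (lex_lt_right h h') (by omega)) (by omega))
  rcases h'' with h'' | ⟨h'', h'''⟩
  · exact .inl (lex_lt (lex_lt_right (mono h h') h'') (by omega))
  rcases h''' with h''' | ⟨h''', h5⟩
  · exact .inl (lex_lt_right (mono (mono h h') h'') h''')
  · exact .inr ⟨mono (mono (mono h h') h'') h''', h5⟩

theorem slack_lt {N x : ℕ} {d d' : ℕ → ℕ} (hx : x < N) (hd : d x < N) (h1 : d' x = d x + 1)
    (h2 : ∀ w, w ≠ x → d' w = d w) : slack N d' < slack N d := by
  refine Finset.sum_lt_sum (fun w _ => ?_) ⟨x, Finset.mem_range.2 hx, by omega⟩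
  by_cases hw : w = x
  · subst hw; omega
  · rw [h2 w hw]

/-! ### The operations of preflow pushing. -/

variable {N : ℕ} {q : ℕ → R} {c r : ℕ → ℕ → R} {e : ℕ → R} {d p : ℕ → ℕ} {u : ℕ}

theorem Inv.next (h : Inv N q c r e d p u) (hu : u < N) (hact : ¬ (0 < e u ∧ d u < N)) :
    Inv N q c r e d p (u + 1) ∧ potential N r e d p (u + 1) < potential N r e d p u := by
  refine ⟨{ h with
    done := fun w h2 hw he => ?_
    two_le := by have := h.two_le; omega
    u_le := hu }, potential_lt (.inr ⟨le_rfl, .inr ⟨le_rfl, .inr ⟨le_rfl, .inr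
      ⟨le_rfl, by omega⟩⟩⟩⟩)⟩
  by_cases hwu : w = u
  · subst hwu
    by_contra! hd
    exact hact ⟨he, hd⟩
  · exact h.done w h2 (by omega) he

theorem Inv.scan {p' : ℕ → ℕ} (h : Inv N q c r e d p u) (hu : u < N) (hp : p u < N)
    (hadm : ¬ (0 < r u (p u) ∧ d (p u) < d u)) (h1 : p' u = p u + 1)
    (h2 : ∀ w, w ≠ u → p' w = p w) :
    Inv N q c r e d p' u ∧ potential N r e d p' u < potential N r e d p u := by
  refine ⟨{ h with
    p_le := fun w => ?_
    scanned := fun v hv w hw hr => ?_ }, potential_lt (.inr ⟨le_rfl, .inr ⟨le_rfl, .inr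
      ⟨le_rfl, .inl (slack_lt hu hp h1 h2)⟩⟩⟩)⟩
  · by_cases hw : w = u
    · subst hw; omega
    · rw [h2 w hw]; exact h.p_le w
  · by_cases hvu : v = u
    · subst hvu
      by_cases hwp : w = p v
      · subst hwp
        by_contra! hd
        exact hadm ⟨hr, hd⟩
      · exact h.scanned v hv w (by omega) hr
    · rw [h2 v hvu] at hw
      exact h.scanned v hv w hw hr

/-- Once all arcs at `u` are scanned, every residual arc leads to a label at least `d u`, so raising
`d u` by one keeps the labelling valid. Arcs into `u` only gain room. -/
theorem Inv.relabel {d' p' : ℕ → ℕ} (h : Inv N q c r e d p u) (hu : u < N) (hd : d u < N)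
    (hp : ¬ p u < N) (h1 : d' u = d u + 1) (h2 : ∀ w, w ≠ u → d' w = d w) (h3 : p' u = 0)
    (h4 : ∀ w, w ≠ u → p' w = p w) :
    Inv N q c r e d' p' u ∧ potential N r e d' p' u < potential N r e d p u := by
  have hu2 := h.two_le
  have hpu := h.p_le u
  have hle : ∀ w, d w ≤ d' w := fun w => by
    by_cases hw : w = u
    · subst hw; omega
    · rw [h2 w hw]
  refine ⟨{ h with
    d_zero := by rw [h2 0 (by omega)]; exact h.d_zero
    d_one := by rw [h2 1 (by omega)]; exact h.d_one
    valid := fun v hv w hw hr => ?_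
    p_le := fun w => ?_
    scanned := fun v hv w hw hr => ?_
    done := fun w hw hwu he => (h.done w hw hwu he).trans (hle w) },
    potential_lt (.inl (slack_lt hu hd h1 h2))⟩
  · have := hle w
    by_cases hvu : v = u
    · subst hvu
      have := h.scanned v hv w (by omega) hr
      omega
    · rw [h2 v hvu]
      have := h.valid v hv w hw hr
      omega
  · by_cases hw : w = u
    · subst hw; omega
    · rw [h4 w hw]; exact h.p_le w
  · by_cases hvu : v = u
    · subst hvu; omega
    · rw [h4 v hvu] at hw
      rw [h2 v hvu]
      exact (h.scanned v hv w hw hr).trans (hle w)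

variable [IsOrderedAddMonoid R]

/-- The only arc that can become residual is `(x, u)`, and it leads to a higher label. Hence
validity and `scanned` survive and no arc becomes admissible. A saturating push removes `(u, x)`
from the admissible arcs; otherwise `u` is emptied and at most the lower vertex `x` becomes active.
-/
theorem Inv.push {r' : ℕ → ℕ → R} {e' : ℕ → R} {x : ℕ} {δ : R} (h : Inv N q c r e d p u)
    (hu : u < N) (hx : x < N) (he : 0 < e u) (hdu : d u < N) (hr : 0 < r u x) (hd : d x < d u)
    (hδe : δ ≤ e u) (hδr : δ ≤ r u x) (hδ : δ = e u ∨ δ = r u x)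
    (hr1 : r' u x = r u x - δ) (hr2 : r' x u = r x u + δ)
    (hr3 : ∀ v w, ¬ (v = u ∧ w = x) → ¬ (v = x ∧ w = u) → r' v w = r v w)
    (he1 : e' u = e u - δ) (he2 : e' x = e x + δ) (he3 : ∀ w, w ≠ u → w ≠ x → e' w = e w) :
    Inv N q c r' e' d p 2 ∧ potential N r' e' d p 2 < potential N r e d p u := by
  classical
  have hxu : x ≠ u := by rintro rfl; omega
  have hu2 := h.two_le
  have hx0 : x ≠ 0 := by rintro rfl; exact hr.ne' (h.r_zero u)
  have hδ0 : 0 < δ := by rcases hδ with rfl | rfl <;> assumption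
  have hpos : ∀ v w, ¬ (v = x ∧ w = u) → 0 < r' v w → 0 < r v w := by
    intro v w hvw hpos
    by_cases h1 : v = u ∧ w = x
    · rw [h1.1, h1.2]; exact hr
    · rwa [hr3 v w h1 hvw] at hpos
  have hadm : ∀ y, Admissible r' d y → Admissible r d y := by
    rintro ⟨v, w⟩ ⟨h1, h2⟩
    refine ⟨hpos v w ?_ h1, h2⟩
    rintro ⟨rfl, rfl⟩
    simp only at h2
    omega
  refine ⟨?_, potential_lt (.inr ⟨le_rfl, ?_⟩)⟩
  · refine { h with
      r_nonneg := fun v w => ?_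
      r_add := fun v w => ?_
      e_nonneg := fun w => ?_
      e_eq := fun w hw => ?_
      e_zero := by rw [he3 0 (by omega) hx0.symm]; exact h.e_zero
      r_zero := fun w => by rw [hr3 w 0 (by omega) (by omega)]; exact h.r_zero w
      valid := fun v hv w hw hvw => ?_
      scanned := fun v hv w hw hvw => ?_
      -- The vertex `x` may have become active anywhere, so the search restarts at `2`, where the
      -- condition is vacuous.
      done := fun w hw hw' => by omega
      two_le := le_rfl
      u_le := by omega }
    · by_cases h1 : v = u ∧ w = x
      · rw [h1.1, h1.2, hr1]; exact sub_nonneg.2 hδr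
      by_cases h2 : v = x ∧ w = u
      · rw [h2.1, h2.2, hr2]; exact add_nonneg (h.r_nonneg _ _) hδ0.le
      rw [hr3 v w h1 h2]; exact h.r_nonneg v w
    · have hadd := h.r_add v w
      by_cases h1 : v = u ∧ w = x
      · rw [h1.1, h1.2] at hadd ⊢
        rw [hr1, hr2, ← hadd]; abel
      by_cases h2 : v = x ∧ w = u
      · rw [h2.1, h2.2] at hadd ⊢
        rw [hr1, hr2, ← hadd]; abel
      rw [hr3 v w h1 h2, hr3 w v (fun h => h2 h.symm) (fun h => h1 h.symm)]; exact hadd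
    · by_cases h1 : w = u
      · rw [h1, he1]; exact sub_nonneg.2 hδe
      by_cases h2 : w = x
      · rw [h2, he2]; exact add_nonneg (h.e_nonneg _) hδ0.le
      rw [he3 w h1 h2]; exact h.e_nonneg w
    · have key : ∑ v ∈ Finset.range N, (c v w - r' v w) =
          ∑ v ∈ Finset.range N, (c v w - r v w) + ∑ v ∈ Finset.range N, (r v w - r' v w) := by
        rw [← Finset.sum_add_distrib]
        exact Finset.sum_congr rfl fun v _ => by abel
      rw [key, ← add_assoc, ← h.e_eq w hw]
      by_cases h1 : w = u
      · subst h1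
        rw [he1, Finset.sum_eq_single x, hr2]
        · abel
        · intro v _ hv
          rw [hr3 v w (by omega) (by omega), sub_self]
        · intro hx'; exact absurd (Finset.mem_range.2 hx) hx'
      by_cases h2 : w = x
      · subst h2
        rw [he2, Finset.sum_eq_single u, hr1]
        · abel
        · intro v _ hv
          rw [hr3 v w (by omega) (by omega), sub_self]
        · intro hu'; exact absurd (Finset.mem_range.2 hu) hu'
      rw [he3 w h1 h2, Finset.sum_eq_zero, add_zero]
      intro v _
      rw [hr3 v w (by omega) (by omega), sub_self]
    · by_cases h2 : v = x ∧ w = u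
      · rw [h2.1, h2.2]; omega
      · exact h.valid v hv w hw (hpos v w h2 hvw)
    · by_cases h2 : v = x ∧ w = u
      · rw [h2.1, h2.2]; omega
      · exact h.scanned v hv w hw (hpos v w h2 hvw)
  · rcases hδ with hδ | hδ
    · refine .inr ⟨Finset.card_le_card (Finset.monotone_filter_right _ fun y _ => hadm y), .inl ?_⟩
      have hzero : ¬ Active N e' d u := fun h' => by
        have := h'.2.1
        rw [he1, hδ, sub_self] at this
        exact lt_irrefl _ this
      -- With `d u` and `d x` added, the two sums can be compared vertex by vertex; `d x < d u` then
      -- makes the decrease strict.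
      have hle : activeLabels N e' d + d u ≤ activeLabels N e d + d x := by
        have e1 : ∑ w ∈ Finset.range N, (if w = u then d u else 0) = d u := by
          simp [hu]
        have e2 : ∑ w ∈ Finset.range N, (if w = x then d x else 0) = d x := by
          simp [hx]
        suffices ∑ w ∈ Finset.range N, ((if Active N e' d w then d w else 0) +
            if w = u then d u else 0) ≤ ∑ w ∈ Finset.range N, ((if Active N e d w then d w else 0) +
            if w = x then d x else 0) by
          rwa [Finset.sum_add_distrib, Finset.sum_add_distrib, e1, e2] at this
        refine Finset.sum_le_sum fun w _ => ?_
        by_cases h1 : w = u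
        · subst h1
          rw [if_neg hzero, if_pos rfl, if_pos ⟨hu2, he, hdu⟩]
          omega
        · by_cases h2 : w = x
          · subst h2
            simp only [h1, if_true, if_false]
            split_ifs <;> omega
          · have : Active N e' d w ↔ Active N e d w := by simp only [Active, he3 w h1 h2]
            simp only [h1, h2, this, if_false, le_refl]
      omega
    · refine .inl (Finset.card_lt_card ((Finset.ssubset_iff_of_subset
        (Finset.monotone_filter_right _ fun y _ => hadm y)).2 ⟨(u, x), ?_, ?_⟩))
      · simp only [Finset.mem_filter, Finset.mem_product, Finset.mem_range]
        exact ⟨⟨hu, hx⟩, hr, hd⟩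
      · simp [Admissible, hr1, hδ]

/-! ### Excess of the sink against cut values. -/

/-- The capacity of the cut that separates `S` from its complement. -/
def cutValue (N : ℕ) (q : ℕ → R) (c : ℕ → ℕ → R) (S : Finset ℕ) : R :=
  ∑ w ∈ Finset.range N \ S, (q w + ∑ v ∈ S, c v w)

/-- Sum the balance equations `e_eq` over the complement of `S`. By `r_add` the net flow `c - r` is
antisymmetric, so arcs inside the complement cancel and only those coming from `S` remain. -/
theorem Inv.sum_excess (h : Inv N q c r e d p u) {S : Finset ℕ} (hS : S ⊆ Finset.range N) :
    ∑ w ∈ Finset.range N \ S, e w + ∑ w ∈ Finset.range N \ S, ∑ v ∈ S, r v w =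
      cutValue N q c S := by
  set C := Finset.range N \ S with hC
  have hanti : ∑ w ∈ C, ∑ v ∈ C, (c v w - r v w) = 0 := by
    have h1 : ∑ w ∈ C, ∑ v ∈ C, (c v w - r v w) = - ∑ w ∈ C, ∑ v ∈ C, (c v w - r v w) := by
      nth_rewrite 1 [Finset.sum_comm]
      rw [← Finset.sum_neg_distrib]
      refine Finset.sum_congr rfl fun w _ => ?_
      rw [← Finset.sum_neg_distrib]
      refine Finset.sum_congr rfl fun v _ => ?_
      have := h.r_add v w
      rw [← sub_eq_zero] at this ⊢
      rw [← neg_eq_zero, ← this]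
      abel
    exact self_eq_neg.1 h1
  have h2 : ∀ w ∈ C, e w = q w + (∑ v ∈ C, (c v w - r v w) + ∑ v ∈ S, (c v w - r v w)) := by
    intro w hw
    rw [h.e_eq w (Finset.mem_range.1 (Finset.mem_sdiff.1 hw).1), Finset.sum_sdiff hS]
  rw [Finset.sum_congr rfl h2, cutValue]
  simp only [Finset.sum_add_distrib, Finset.sum_sub_distrib] at hanti ⊢
  rw [hanti]
  abel

/-- Weak duality: in `sum_excess` all terms other than `e 1` are nonnegative. -/
theorem Inv.excess_le (h : Inv N q c r e d p u) (hN : 2 ≤ N) {S : Finset ℕ}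
    (hS : S ⊆ Finset.range N) (h1 : 1 ∉ S) : e 1 ≤ cutValue N q c S := by
  rw [← h.sum_excess hS]
  have h2 : e 1 ≤ ∑ w ∈ Finset.range N \ S, e w :=
    Finset.single_le_sum (f := e) (fun w _ => h.e_nonneg w)
      (Finset.mem_sdiff.2 ⟨Finset.mem_range.2 hN, h1⟩)
  exact h2.trans (le_add_of_nonneg_right
    (Finset.sum_nonneg fun w _ => Finset.sum_nonneg fun v _ => h.r_nonneg v w))

/-- Cut above an unused label `k`. A residual arc descends by at most one label, so none jumps over
the gap, and below the gap `done` leaves excess at the sink only. Then `sum_excess` collapses to `e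
1`. -/
theorem Inv.exists_cut (h : Inv N q c r e d p N) :
    ∃ S ⊆ Finset.range N, 1 ∉ S ∧ cutValue N q c S = e 1 := by
  classical
  have hN := h.two_le
  -- Pigeonhole: the `N - 2` vertices from `2` on cannot use all `N - 1` labels from `1` to `N - 1`,
  -- and the vertices `0` and `1` have label `0`.
  obtain ⟨k, hk, hkd⟩ : ∃ k ∈ Finset.Ico 1 N, k ∉ (Finset.Ico 2 N).image d := by
    refine Finset.exists_mem_notMem_of_card_lt_card (Finset.card_image_le.trans_lt ?_)
    simp only [Nat.card_Ico]
    omega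
  rw [Finset.mem_Ico] at hk
  have hgap : ∀ w < N, d w ≠ k := by
    intro w hw hdw
    have h0 := h.d_zero
    have h1 := h.d_one
    rcases Nat.lt_or_ge w 2 with h2 | h2
    · interval_cases w <;> omega
    · exact hkd (Finset.mem_image.2 ⟨w, Finset.mem_Ico.2 ⟨h2, hw⟩, hdw⟩)
  refine ⟨(Finset.range N).filter (fun w => k < d w), Finset.filter_subset _ _, ?_, ?_⟩
  · have := h.d_one
    simp [this]
  · rw [← h.sum_excess (Finset.filter_subset _ _), Finset.sum_eq_single 1, Finset.sum_eq_zero,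
      add_zero]
    · intro w hw
      refine Finset.sum_eq_zero fun v hv => ?_
      simp only [Finset.mem_sdiff, Finset.mem_filter, Finset.mem_range, not_and, not_lt] at hw hv
      refine le_antisymm ?_ (h.r_nonneg v w)
      by_contra! hpos
      have h1 := h.valid v hv.1 w hw.1 hpos
      have h2 := hw.2 hw.1
      have h3 := hgap w hw.1
      omega
    · intro w hw hw1
      simp only [Finset.mem_sdiff, Finset.mem_filter, Finset.mem_range, not_and, not_lt] at hw
      by_cases h0 : w = 0
      · rw [h0]; exact h.e_zero
      refine le_antisymm ?_ (h.e_nonneg w)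
      by_contra! hpos
      have h1 := h.done w (by omega) hw.1 hpos
      have h2 := hw.2 hw.1
      omega
    · intro h1
      simp [h.d_one] at h1
      omega

end Preflow

/-! ### Running times in unit cost -/

namespace RAM

/-- Number of steps that evaluating an index expression takes. -/
def IExpr.time : IExpr → ℕ
  | .lit _ => 1
  | .cell _ e f => e.time + f.time + 1
  | .add e f => e.time + f.time + 1
  | .sub e f => e.time + f.time + 1

/-- Number of steps that evaluating a number expression takes. -/
def NExpr.time : NExpr → ℕ
  | .zero => 1
  | .cell _ e f => e.time + f.time + 1
  | .add x y => x.time + y.time + 1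
  | .sub x y => x.time + y.time + 1

/-- Number of steps that a test takes. -/
def Test.time : Test → ℕ
  | .lt e f => e.time + f.time + 1
  | .le x y => x.time + y.time + 1
  | .not c => c.time + 1
  | .and c d => c.time + d.time + 1

/-- A bound for the number of steps of a program without loops. -/
def Prog.time : Prog → ℕ
  | .skip => 1
  | .setIdx _ e f v => e.time + f.time + v.time + 1
  | .setNum _ e f v => e.time + f.time + v.time + 1
  | .seq P Q => P.time + Q.time
  | .ite c P Q => c.time + (P.time + Q.time)
  | .while c P => c.time + P.time

variable {R : Type}

theorem IExpr.cost_unitCost (σ : Store R) (e : IExpr) : e.cost (unitCost R) σ = e.time := by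
  induction e <;> simp_all [IExpr.cost, IExpr.time, unitCost]

variable [AddCommGroup R]

theorem NExpr.cost_unitCost (σ : Store R) (x : NExpr) : x.cost (unitCost R) σ = x.time := by
  induction x <;> simp_all [NExpr.cost, NExpr.time, IExpr.cost_unitCost] <;> simp [unitCost]

theorem Test.cost_unitCost (σ : Store R) (c : Test) : c.cost (unitCost R) σ = c.time := by
  induction c <;> simp_all [Test.cost, Test.time, IExpr.cost_unitCost, NExpr.cost_unitCost]

variable [LinearOrder R]

/-- Started in `σ`, the program `P` halts after at most `T` steps in a store that satisfies `Q`. -/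
def Runs (P : Prog) (σ : Store R) (T : ℕ) (Q : Store R → Prop) : Prop :=
  ∃ T' σ', Exec (unitCost R) P σ T' σ' ∧ T' ≤ T ∧ Q σ'

theorem Runs.mono {P : Prog} {σ : Store R} {T T' : ℕ} {Q Q' : Store R → Prop} (h : Runs P σ T Q)
    (hT : T ≤ T') (hQ : ∀ σ', Q σ' → Q' σ') : Runs P σ T' Q' := by
  obtain ⟨T₁, σ', h1, h2, h3⟩ := h
  exact ⟨T₁, σ', h1, h2.trans hT, hQ _ h3⟩

theorem Runs.seq {P P' : Prog} {σ : Store R} {T T' : ℕ} {Q : Store R → Prop}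
    (h : Runs P σ T fun σ' => Runs P' σ' T' Q) : Runs (.seq P P') σ (T + T') Q := by
  obtain ⟨T₁, σ₁, h1, h2, T₂, σ₂, h3, h4, h5⟩ := h
  exact ⟨_, σ₂, .seq h1 h3, add_le_add h2 h4, h5⟩

/-- The weakest precondition of a program without loops. -/
def Prog.wp : Prog → (Store R → Prop) → Store R → Prop
  | .skip, Q, σ => Q σ
  | .setIdx k e f v, Q, σ => Q (σ.setIdx k (e.eval σ) (f.eval σ) (v.eval σ))
  | .setNum k e f v, Q, σ => Q (σ.setNum k (e.eval σ) (f.eval σ) (v.eval σ))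
  | .seq P P', Q, σ => P.wp (P'.wp Q) σ
  | .ite c P P', Q, σ => (c.Holds σ → P.wp Q σ) ∧ (¬ c.Holds σ → P'.wp Q σ)
  | .while _ _, _, _ => False

theorem Prog.wp.runs {P : Prog} {Q : Store R → Prop} {σ : Store R} (h : P.wp Q σ) :
    Runs P σ P.time Q := by
  induction P generalizing Q σ with
  | skip => exact ⟨_, _, .skip σ, le_rfl, h⟩
  | setIdx k e f v =>
    refine ⟨_, _, .setIdx σ k e f v, ?_, h⟩
    simp only [IExpr.cost_unitCost, Prog.time, le_refl]
  | setNum k e f v =>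
    refine ⟨_, _, .setNum σ k e f v, ?_, h⟩
    simp only [IExpr.cost_unitCost, NExpr.cost_unitCost, Prog.time, le_refl]
  | seq P P' ih ih' => exact ((ih h).mono le_rfl fun σ' h' => ih' h').seq
  | ite c P P' ih ih' =>
    by_cases hc : c.Holds σ
    · obtain ⟨T, σ', h1, h2, h3⟩ := ih (h.1 hc)
      refine ⟨_, σ', .iteTrue hc h1, ?_, h3⟩
      simp only [Test.cost_unitCost, Prog.time]
      omega
    · obtain ⟨T, σ', h1, h2, h3⟩ := ih' (h.2 hc)
      refine ⟨_, σ', .iteFalse hc h1, ?_, h3⟩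
      simp only [Test.cost_unitCost, Prog.time]
      omega
  | _ => exact h.elim

/-- The measure `μ` bounds the number of iterations; the extra one pays for the final failing test.
-/
theorem Runs.while {c : Test} {P : Prog} {t : ℕ} {J : Store R → Prop} {μ : Store R → ℕ}
    (hP : ∀ σ, J σ → c.Holds σ → Runs P σ t fun σ' => J σ' ∧ μ σ' < μ σ) {σ : Store R} (hσ : J σ) :
    Runs (.while c P) σ ((μ σ + 1) * (c.time + t)) fun σ' => J σ' ∧ ¬ c.Holds σ' := by
  induction hn : μ σ using Nat.strong_induction_on generalizing σ with
  | _ n ih =>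
    by_cases hc : c.Holds σ
    · obtain ⟨T, σ', h1, h2, h3, h4⟩ := hP σ hσ hc
      obtain ⟨T', σ'', h5, h6, h7⟩ := ih _ (hn ▸ h4) h3 rfl
      refine ⟨_, σ'', .whileTrue hc h1 h5, ?_, h7⟩
      rw [Test.cost_unitCost]
      have : (μ σ' + 1) * (c.time + t) ≤ n * (c.time + t) := Nat.mul_le_mul_right _ (by omega)
      linarith
    · refine ⟨_, σ, .whileFalse hc, ?_, hσ, hc⟩
      rw [Test.cost_unitCost]
      nlinarith [Nat.zero_le (n * (c.time + t))]

/-- The scalar variable number `k`. -/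
def scalar (k : ℕ) : IExpr := .cell 7 (.lit 0) (.lit k)

/-- The loop in which the variable number `k` runs through the naturals below the entry `[0, b]`
of the index array `0`. -/
def forLoop (k b : ℕ) (P : Prog) : Prog :=
  .seq (.setIdx 7 (.lit 0) (.lit k) (.lit 0))
    (.while (.lt (scalar k) (.cell 0 (.lit 0) (.lit b)))
      (.seq P (.setIdx 7 (.lit 0) (.lit k) (.add (scalar k) (.lit 1)))))

theorem Runs.forLoop {k b n t : ℕ} {P : Prog} {J : ℕ → Store R → Prop} {Q : Store R → Prop}
    {σ : Store R} (h0 : J 0 σ) (hset : ∀ m σ v, J m σ → J m (σ.setIdx 7 0 k v))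
    (hb : ∀ m σ, J m σ → σ.idx 0 0 b = n)
    (hP : ∀ m < n, ∀ σ, J m σ → σ.idx 7 0 k = m →
      Runs P σ t fun σ' => J (m + 1) σ' ∧ σ'.idx 7 0 k = m)
    (hQ : ∀ σ, J n σ → Q σ) : Runs (forLoop k b P) σ ((n + 1) * (t + 19)) Q := by
  have hstep : ∀ σ : Store R, (∃ m ≤ n, J m σ ∧ σ.idx 7 0 k = m) →
      (Test.lt (scalar k) (.cell 0 (.lit 0) (.lit b))).Holds σ →
      Runs (.seq P (.setIdx 7 (.lit 0) (.lit k) (.add (scalar k) (.lit 1)))) σ (t + 8)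
        fun σ' => (∃ m ≤ n, J m σ' ∧ σ'.idx 7 0 k = m) ∧ n - σ'.idx 7 0 k < n - σ.idx 7 0 k := by
    rintro σ ⟨m, hm, hJ, hk⟩ hc
    simp only [Test.Holds, scalar, IExpr.eval, hb m σ hJ, hk] at hc
    refine ((hP m hc σ hJ hk).mono le_rfl fun σ' h' => ?_).seq
    refine Prog.wp.runs (P := .setIdx 7 (.lit 0) (.lit k) (.add (scalar k) (.lit 1))) ?_
    simp only [Prog.wp, IExpr.eval, scalar, h'.2]
    refine ⟨⟨m + 1, hc, hset _ _ _ h'.1, by simp [Store.setIdx]⟩, ?_⟩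
    simp only [Store.setIdx, and_self, if_true, hk]
    omega
  have hstart : ∃ m ≤ n, J m (σ.setIdx 7 0 k 0) ∧ (σ.setIdx 7 0 k 0).idx 7 0 k = m :=
    ⟨0, Nat.zero_le _, hset _ _ _ h0, by simp [Store.setIdx]⟩
  have hloop := Runs.while (J := fun σ' : Store R => ∃ m ≤ n, J m σ' ∧ σ'.idx 7 0 k = m)
    (μ := fun σ' => n - σ'.idx 7 0 k) hstep hstart
  have hrun : Runs (RAM.forLoop k b P) σ (4 + (n + 1) * (7 + (t + 8))) Q := by
    refine Runs.seq (Prog.wp.runs (P := .setIdx 7 (.lit 0) (.lit k) (.lit 0))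
      (hloop.mono (Nat.mul_le_mul ?_ le_rfl) ?_))
    · have : (σ.setIdx 7 0 k 0).idx 7 0 k = 0 := by simp [Store.setIdx]
      omega
    · rintro σ' ⟨⟨m, hm, hJ, hk⟩, hc⟩
      simp only [Test.Holds, scalar, IExpr.eval, hb m σ' hJ, hk] at hc
      obtain rfl : m = n := by omega
      exact hQ _ hJ
  -- The constant `19` consists of `4` for initialising the counter, `7` for the test and `8` for
  -- the increment.
  exact hrun.mono (by nlinarith) fun _ h => h

end RAM

/-! ### Building the network -/

namespace RPSP

open RAM

/-- The dimension number `b` of the instance. -/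
def dim (b : ℕ) : IExpr := .cell 0 (.lit 0) (.lit b)

/-- The code of the penalty vertex in the variable number `1`. -/
def penaltyCode : IExpr := .add (.lit 2) (scalar 1)

/-- The code of the reward vertex in the variable number `0`. -/
def rewardCode : IExpr := .add (.add (.lit 2) (dim 2)) (scalar 0)

/-- Entering the penalties. -/
def penaltyStep : Prog :=
  .seq (.setNum 3 (.lit 0) penaltyCode (.cell 1 (.lit 0) (scalar 1)))
    (.seq (.setNum 5 (.lit 0) penaltyCode (.cell 1 (.lit 0) (scalar 1)))
      (.setNum 6 (.lit 0) (.lit 0)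
        (.add (.cell 6 (.lit 0) (.lit 0)) (.cell 1 (.lit 0) (scalar 1)))))

/-- Entering the rewards. -/
def rewardStep : Prog :=
  .seq (.setNum 3 rewardCode (.lit 1) (.cell 0 (.lit 0) (scalar 0)))
    (.seq (.setNum 8 rewardCode (.lit 1) (.cell 0 (.lit 0) (scalar 0)))
      (.setNum 4 (.lit 0) (.lit 0)
        (.add (.cell 4 (.lit 0) (.lit 0)) (.cell 0 (.lit 0) (scalar 0)))))

/-- Entering an infinite capacity, if the player in the variable number `2` requires it. -/
def arcStep : Prog :=
  .ite (.and (.lt (.lit 0) (.cell 1 (scalar 0) (scalar 2)))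
      (.lt (.lit 0) (.cell 2 (scalar 1) (scalar 2))))
    (.seq (.setIdx 4 penaltyCode rewardCode (.lit 1))
      (.setNum 8 penaltyCode rewardCode (.cell 6 (.lit 0) (.lit 0))))
    .skip

/-- The program that builds the network and the threshold; the number arrays `5` and `8` receive
the supplies and the capacities for preflow pushing. -/
def buildProg : Prog :=
  .seq (.seq (.setIdx 3 (.lit 0) (.lit 0) (.add (.add (dim 1) (dim 2)) (.lit 2)))
      (.setNum 4 (.lit 0) (.lit 0) (.sub .zero (.cell 2 (.lit 0) (.lit 0)))))
    (.seq (forLoop 1 2 penaltyStep)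
      (.seq (forLoop 0 1 rewardStep)
        (forLoop 1 2 (forLoop 0 1 (forLoop 2 0 arcStep)))))

variable {R : Type} [AddCommGroup R] [LinearOrder R]

/-- One of the triples `(j, i, u)` in `F` shows that the sets behind the vertices with codes `v`
and `w` share a player. -/
def Meets (I : RPSP R) (α : R) (F : Set (ℕ × ℕ × ℕ)) (v w : ℕ) : Prop :=
  ∃ j i u, (j, i, u) ∈ F ∧ v = 2 + j ∧ w = 2 + I.l + i ∧
    0 < (I.input α).idx 1 i u ∧ 0 < (I.input α).idx 2 j u

/-- The sum of the first `y` penalties. -/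
def penaltySum (I : RPSP R) (α : R) (y : ℕ) : R := ∑ j ∈ Finset.range y, (I.input α).num 1 0 j

open Classical in
/-- The state of `buildProg` when `x` rewards, `y` penalties and the triples in `F` have been
entered. -/
structure Built (I : RPSP R) (α : R) (x y : ℕ) (F : Set (ℕ × ℕ × ℕ)) (σ : Store R) : Prop where
  idx0 : σ.idx 0 = (I.input α).idx 0
  idx1 : σ.idx 1 = (I.input α).idx 1
  idx2 : σ.idx 2 = (I.input α).idx 2
  num0 : σ.num 0 = (I.input α).num 0
  num1 : σ.num 1 = (I.input α).num 1
  size : σ.idx 3 0 0 = I.h + I.l + 2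
  flag : ∀ v w, σ.idx 4 v w = if Meets I α F v w then 1 else 0
  label : ∀ w, σ.idx 5 0 w = 0
  arc : ∀ w, σ.idx 6 0 w = 0
  cap : ∀ v w, σ.num 3 v w =
    if v = 0 ∧ 2 ≤ w ∧ w < 2 + y then (I.input α).num 1 0 (w - 2)
    else if w = 1 ∧ 2 + I.l ≤ v ∧ v < 2 + I.l + x then (I.input α).num 0 0 (v - (2 + I.l)) else 0
  threshold : σ.num 4 0 0 = ∑ i ∈ Finset.range x, (I.input α).num 0 0 i - α
  supply : ∀ w, σ.num 5 0 w = if 2 ≤ w ∧ w < 2 + y then (I.input α).num 1 0 (w - 2) else 0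
  total : σ.num 6 0 0 = penaltySum I α y
  residual : ∀ v w, σ.num 8 v w =
    if w = 1 ∧ 2 + I.l ≤ v ∧ v < 2 + I.l + x then (I.input α).num 0 0 (v - (2 + I.l))
    else if Meets I α F v w then penaltySum I α I.l else 0

variable {I : RPSP R} {α : R}

theorem Built.setScalar {x y : ℕ} {F : Set (ℕ × ℕ × ℕ)} {σ : Store R} (h : Built I α x y F σ)
    (k v : ℕ) : Built I α x y F (σ.setIdx 7 0 k v) := by
  constructor <;> simp only [Store.setIdx, Nat.reduceEqDiff, false_and, if_false, h.idx0, h.idx1,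
    h.idx2, h.num0, h.num1, h.size, h.flag, h.label, h.arc, h.cap, h.threshold, h.supply, h.total,
    h.residual, implies_true]

theorem Built.congr {x y : ℕ} {F F' : Set (ℕ × ℕ × ℕ)} {σ : Store R} (h : Built I α x y F σ)
    (hF : F = F') : Built I α x y F' σ := hF ▸ h

theorem Built.penaltyStep {y : ℕ} {F : Set (ℕ × ℕ × ℕ)} {σ : Store R} (h : Built I α 0 y F σ)
    (hy : σ.idx 7 0 1 = y) :
    Prog.wp penaltyStep (fun σ' => Built I α 0 (y + 1) F σ' ∧ σ'.idx 7 0 1 = y) σ := by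
  simp only [Prog.wp, RPSP.penaltyStep, penaltyCode, scalar, IExpr.eval, NExpr.eval, Store.setNum,
    hy]
  refine ⟨⟨h.idx0, h.idx1, h.idx2, ?_, ?_, h.size, h.flag, h.label, h.arc, ?_, ?_, ?_, ?_, ?_⟩, ?_⟩
  · simp [h.num0]
  · simp [h.num1]
  · intro v w
    simp only [Nat.reduceEqDiff, false_and, if_false, true_and, h.cap, h.num1]
    by_cases h1 : v = 0 ∧ w = 2 + y
    · simp [h1]
    · rw [if_neg h1]
      congr 1
      rw [eq_iff_iff]
      omega
  · simp [h.threshold]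
  · intro w
    simp only [Nat.reduceEqDiff, false_and, if_false, true_and, h.supply, h.num1]
    by_cases h1 : w = 2 + y
    · simp [h1]
    · rw [if_neg h1]
      congr 1
      rw [eq_iff_iff]
      omega
  · simp [h.total, h.num1, penaltySum, Finset.sum_range_succ]
  · simp [h.residual]
  · simp

theorem Built.rewardStep {x : ℕ} {σ : Store R} (h : Built I α x I.l ∅ σ)
    (hx : σ.idx 7 0 0 = x) :
    Prog.wp rewardStep (fun σ' => Built I α (x + 1) I.l ∅ σ' ∧ σ'.idx 7 0 0 = x) σ := by
  have hl : σ.idx 0 0 2 = I.l := by rw [h.idx0]; rfl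
  simp only [Prog.wp, RPSP.rewardStep, rewardCode, dim, scalar, IExpr.eval, NExpr.eval,
    Store.setNum, hx, hl]
  refine ⟨⟨h.idx0, h.idx1, h.idx2, ?_, ?_, h.size, h.flag, h.label, h.arc, ?_, ?_, ?_, ?_, ?_⟩, ?_⟩
  · simp [h.num0]
  · simp [h.num1]
  · intro v w
    simp only [Nat.reduceEqDiff, false_and, if_false, true_and, h.cap, h.num0]
    by_cases h1 : v = 2 + I.l + x ∧ w = 1
    · simp [h1]
    · rw [if_neg h1]
      congr 2
      rw [eq_iff_iff]
      omega
  · simp [h.threshold, h.num0, Finset.sum_range_succ]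
    abel
  · simp [h.supply]
  · simp [h.total]
  · intro v w
    simp only [Nat.reduceEqDiff, false_and, if_false, true_and, h.residual, h.num0]
    by_cases h1 : v = 2 + I.l + x ∧ w = 1
    · simp [h1]
    · rw [if_neg h1]
      congr 1
      rw [eq_iff_iff]
      omega
  · simp

theorem Built.arcStep {j i u : ℕ} {F : Set (ℕ × ℕ × ℕ)} {σ : Store R}
    (h : Built I α I.h I.l F σ) (hi : σ.idx 7 0 0 = i) (hj : σ.idx 7 0 1 = j)
    (hu : σ.idx 7 0 2 = u) :
    Prog.wp arcStep (fun σ' => Built I α I.h I.l (insert (j, i, u) F) σ' ∧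
      σ'.idx 7 0 0 = i ∧ σ'.idx 7 0 1 = j ∧ σ'.idx 7 0 2 = u) σ := by
  classical
  have hl : σ.idx 0 0 2 = I.l := by rw [h.idx0]; rfl
  simp only [Prog.wp, RPSP.arcStep, penaltyCode, rewardCode, dim, scalar, IExpr.eval, NExpr.eval,
    Test.Holds, Store.setNum, Store.setIdx, hi, hj, hu, hl, h.idx1, h.idx2]
  constructor
  · intro hpos
    have hmeet : ∀ v w, Meets I α (insert (j, i, u) F) v w ↔
        (v = 2 + j ∧ w = 2 + I.l + i) ∨ Meets I α F v w := by
      intro v w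
      constructor
      · rintro ⟨j', i', u', h1 | h1, hv, hw, h2, h3⟩
        · simp only [Prod.mk.injEq] at h1
          obtain ⟨rfl, rfl, rfl⟩ := h1
          exact .inl ⟨hv, hw⟩
        · exact .inr ⟨j', i', u', h1, hv, hw, h2, h3⟩
      · rintro (⟨rfl, rfl⟩ | ⟨j', i', u', h1, hv, hw, h2, h3⟩)
        · exact ⟨j, i, u, .inl rfl, rfl, rfl, hpos⟩
        · exact ⟨j', i', u', .inr h1, hv, hw, h2, h3⟩
    have hite : ∀ {β : Type} (v w : ℕ) (y z : β),
        (if Meets I α (insert (j, i, u) F) v w then y else z) =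
          if v = 2 + j ∧ w = 2 + I.l + i then y else if Meets I α F v w then y else z := by
      intro β v w y z
      have := hmeet v w
      split_ifs <;> tauto
    refine ⟨⟨?_, ?_, ?_, ?_, ?_, ?_, ?_, ?_, ?_, ?_, ?_, ?_, ?_, ?_⟩, ?_⟩
    · simp [h.idx0]
    · simp [h.idx1]
    · simp [h.idx2]
    · simp [h.num0]
    · simp [h.num1]
    · simp [h.size]
    · intro v w
      simp only [true_and, h.flag, hite]
    · simp [h.label]
    · simp [h.arc]
    · simp [h.cap]
    · simp [h.threshold]
    · simp [h.supply]
    · simp [h.total]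
    · intro v w
      simp only [Nat.reduceEqDiff, false_and, if_false, true_and, h.residual, hite, h.total]
      by_cases h1 : v = 2 + j ∧ w = 2 + I.l + i
      · have h2 : ¬ (w = 1 ∧ 2 + I.l ≤ v ∧ v < 2 + I.l + I.h) := by omega
        rw [if_pos h1, if_neg h2, if_pos h1]
      · rw [if_neg h1, if_neg h1]
    · simp
  · intro hneg
    have hmeet : ∀ v w, Meets I α (insert (j, i, u) F) v w ↔ Meets I α F v w := by
      intro v w
      constructor
      · rintro ⟨j', i', u', h1 | h1, hv, hw, h2, h3⟩
        · simp only [Prod.mk.injEq] at h1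
          obtain ⟨rfl, rfl, rfl⟩ := h1
          exact absurd ⟨h2, h3⟩ hneg
        · exact ⟨j', i', u', h1, hv, hw, h2, h3⟩
      · rintro ⟨j', i', u', h1, hv, hw, h2, h3⟩
        exact ⟨j', i', u', .inr h1, hv, hw, h2, h3⟩
    have hite : ∀ {β : Type} (v w : ℕ) (y z : β),
        (if Meets I α (insert (j, i, u) F) v w then y else z) =
          if Meets I α F v w then y else z := by
      intro β v w y z
      have := hmeet v w
      split_ifs <;> tauto
    exact ⟨{ h with
      flag := fun v w => by rw [h.flag, hite]
      residual := fun v w => by rw [h.residual, hite] }, trivial, trivial, trivial⟩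

/-- The triples `(j, i, u)` of a penalty set, a reward set and a player. -/
def triples (I : RPSP R) : Set (ℕ × ℕ × ℕ) := {x | x.1 < I.l ∧ x.2.1 < I.h ∧ x.2.2 < I.n}

/-- The loop invariants take for `F` the triples that precede the current one lexicographically. -/
theorem Built.arcLoops {σ : Store R} (h : Built I α I.h I.l ∅ σ) :
    Runs (forLoop 1 2 (forLoop 0 1 (forLoop 2 0 RPSP.arcStep))) σ
      ((I.l + 1) * ((I.h + 1) * ((I.n + 1) * (RPSP.arcStep.time + 19) + 19) + 19))
      (Built I α I.h I.l (triples I)) := by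
  refine Runs.forLoop (J := fun m σ => Built I α I.h I.l {x ∈ triples I | x.1 < m} σ) (by simpa)
    (fun m σ v h => h.setScalar _ _) (fun m σ h => by rw [h.idx0]; rfl) ?_ ?_
  · intro j hj σ h hσj
    refine Runs.forLoop (J := fun m σ => Built I α I.h I.l
      {x ∈ triples I | x.1 < j ∨ x.1 = j ∧ x.2.1 < m} σ ∧ σ.idx 7 0 1 = j)
      ⟨h.congr (by ext ⟨j', i', u'⟩; simp [triples]), hσj⟩
      (fun m σ v h => ⟨h.1.setScalar _ _, by simp [Store.setIdx, h.2]⟩)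
      (fun m σ h => by rw [h.1.idx0]; rfl) ?_ ?_
    · rintro i hi σ ⟨h, hσj⟩ hσi
      refine Runs.forLoop (J := fun m σ => Built I α I.h I.l
        {x ∈ triples I | x.1 < j ∨ x.1 = j ∧ (x.2.1 < i ∨ x.2.1 = i ∧ x.2.2 < m)} σ ∧
          σ.idx 7 0 0 = i ∧ σ.idx 7 0 1 = j)
        ⟨h.congr (by ext ⟨j', i', u'⟩; simp [triples]), hσi, hσj⟩
        (fun m σ v h => ⟨h.1.setScalar _ _, by simp [Store.setIdx, h.2]⟩)
        (fun m σ h => by rw [h.1.idx0]; rfl) ?_ ?_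
      · rintro u hu σ ⟨h, hσi, hσj⟩ hσu
        refine (h.arcStep hσi hσj hσu).runs.mono le_rfl fun σ' h' => ⟨⟨?_, h'.2.1, h'.2.2.1⟩,
          h'.2.2.2⟩
        refine h'.1.congr ?_
        ext ⟨j', i', u'⟩
        simp only [triples, Set.mem_ofPred_eq, Set.mem_insert_iff, Prod.mk.injEq]
        omega
      · rintro σ ⟨h, hσi, hσj⟩
        refine ⟨⟨?_, hσj⟩, hσi⟩
        refine h.congr ?_
        ext ⟨j', i', u'⟩
        simp only [triples, Set.mem_ofPred_eq]
        omega
    · rintro σ ⟨h, hσj⟩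
      refine ⟨?_, hσj⟩
      refine h.congr ?_
      ext ⟨j', i', u'⟩
      simp only [triples, Set.mem_ofPred_eq]
      omega
  · intro σ h
    refine h.congr ?_
    ext ⟨j', i', u'⟩
    simp only [triples, Set.mem_ofPred_eq]
    omega

theorem built_zero (I : RPSP R) (α : R) :
    Prog.wp (.seq (.setIdx 3 (.lit 0) (.lit 0) (.add (.add (dim 1) (dim 2)) (.lit 2)))
      (.setNum 4 (.lit 0) (.lit 0) (.sub .zero (.cell 2 (.lit 0) (.lit 0)))))
      (Built I α 0 0 ∅) (I.input α) := by
  simp only [Prog.wp, dim, IExpr.eval, NExpr.eval, Store.setNum, Store.setIdx]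
  have hfalse : ∀ v w, ¬ Meets I α ∅ v w := by rintro v w ⟨_, _, _, h, _⟩; exact h
  have hlt : ∀ w, ¬ (2 ≤ w ∧ w < 2) := fun w => by omega
  have hlt' : ∀ v, ¬ (2 + I.l ≤ v ∧ v < 2 + I.l) := fun v => by omega
  constructor <;> simp only [add_zero, hlt, hlt', and_false, if_false, hfalse, penaltySum] <;>
    simp [input]

/-- The number of steps of `buildProg`. -/
def buildTime (n h l : ℕ) : ℕ :=
  21 + ((l + 1) * (penaltyStep.time + 19) + ((h + 1) * (rewardStep.time + 19) +
    (l + 1) * ((h + 1) * ((n + 1) * (arcStep.time + 19) + 19) + 19)))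

theorem runs_buildProg (I : RPSP R) (α : R) :
    Runs buildProg (I.input α) (buildTime I.n I.h I.l) (Built I α I.h I.l (triples I)) := by
  refine Runs.seq ((built_zero I α).runs.mono (T' := 21) (by decide) fun σ h => Runs.seq ?_)
  refine Runs.forLoop (J := fun m σ => Built I α 0 m ∅ σ) h (fun m σ v h => h.setScalar _ _)
    (fun m σ h => by rw [h.idx0]; rfl) (fun m _ σ h hm => (h.penaltyStep hm).runs)
    fun σ h => Runs.seq ?_
  exact Runs.forLoop (J := fun m σ => Built I α m I.l ∅ σ) h (fun m σ v h => h.setScalar _ _)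
    (fun m σ h => by rw [h.idx0]; rfl) (fun m _ σ h hm => (h.rewardStep hm).runs)
    fun σ h => h.arcLoops

end RPSP

/-! ### Preflow pushing as a program -/

namespace Preflow

open RAM

/-- The current vertex. -/
def vertex : IExpr := scalar 3

/-- The end of the current arc of the current vertex. -/
def arcEnd : IExpr := .cell 6 (.lit 0) vertex

/-- The label of a vertex. -/
def labelOf (v : IExpr) : IExpr := .cell 5 (.lit 0) v

/-- The number of vertices. -/
def order : IExpr := .cell 3 (.lit 0) (.lit 0)

/-- The excess of a vertex. -/
def excess (v : IExpr) : NExpr := .cell 5 (.lit 0) v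

/-- The amount that is pushed. -/
def amount : NExpr := .cell 7 (.lit 0) (.lit 0)

/-- Pushing along the current arc of the current vertex. -/
def pushProg : Prog :=
  .seq (.ite (.le (excess vertex) (.cell 8 vertex arcEnd))
      (.setNum 7 (.lit 0) (.lit 0) (excess vertex))
      (.setNum 7 (.lit 0) (.lit 0) (.cell 8 vertex arcEnd)))
    (.seq (.setNum 8 vertex arcEnd (.sub (.cell 8 vertex arcEnd) amount))
      (.seq (.setNum 8 arcEnd vertex (.add (.cell 8 arcEnd vertex) amount))
        (.seq (.setNum 5 (.lit 0) vertex (.sub (excess vertex) amount))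
          (.seq (.setNum 5 (.lit 0) arcEnd (.add (excess arcEnd) amount))
            (.setIdx 7 (.lit 0) (.lit 3) (.lit 2))))))

/-- One step of preflow pushing. -/
def stepProg : Prog :=
  .ite (.and (.not (.le (excess vertex) .zero)) (.lt (labelOf vertex) order))
    (.ite (.lt arcEnd order)
      (.ite (.and (.not (.le (.cell 8 vertex arcEnd) .zero))
          (.lt (labelOf arcEnd) (labelOf vertex)))
        pushProg
        (.setIdx 6 (.lit 0) vertex (.add arcEnd (.lit 1))))
      (.seq (.setIdx 5 (.lit 0) vertex (.add (labelOf vertex) (.lit 1)))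
        (.setIdx 6 (.lit 0) vertex (.lit 0))))
    (.setIdx 7 (.lit 0) (.lit 3) (.add vertex (.lit 1)))

variable {R : Type} [AddCommGroup R] [LinearOrder R]

/-- The store holds a state of preflow pushing and the threshold `τ`. -/
structure State (N : ℕ) (q : ℕ → R) (c : ℕ → ℕ → R) (τ : R) (σ : Store R) : Prop where
  size : σ.idx 3 0 0 = N
  threshold : σ.num 4 0 0 = τ
  inv : Inv N q c (σ.num 8) (σ.num 5 0) (σ.idx 5 0) (σ.idx 6 0) (σ.idx 7 0 3)

/-- The potential of the state in a store. -/
noncomputable def storePotential (N : ℕ) (σ : Store R) : ℕ :=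
  potential N (σ.num 8) (σ.num 5 0) (σ.idx 5 0) (σ.idx 6 0) (σ.idx 7 0 3)

variable [IsOrderedAddMonoid R] {N : ℕ} {q : ℕ → R} {c : ℕ → ℕ → R} {τ : R}

theorem State.wp_pushProg {σ : Store R} (h : State N q c τ σ) {u x : ℕ} (hu : σ.idx 7 0 3 = u)
    (hx : σ.idx 6 0 u = x) (huN : u < N) (hxN : x < N) (he : 0 < σ.num 5 0 u)
    (hd : σ.idx 5 0 u < N) (hr : 0 < σ.num 8 u x) (hlt : σ.idx 5 0 x < σ.idx 5 0 u) :
    pushProg.wp (fun σ' => State N q c τ σ' ∧ storePotential N σ' < storePotential N σ) σ := by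
  -- Without this, the successive updates of the two residual capacities and of the two excesses
  -- would overwrite each other.
  have hux : u ≠ x := by rintro rfl; omega
  have hinv := h.inv
  rw [hu] at hinv
  simp only [Prog.wp, pushProg, excess, vertex, arcEnd, scalar, amount, IExpr.eval, NExpr.eval,
    Test.Holds, Store.setNum, Store.setIdx, hu, hx]
  have key : ∀ δ, (δ = σ.num 5 0 u ∨ δ = σ.num 8 u x) → δ ≤ σ.num 5 0 u → δ ≤ σ.num 8 u x →
      ∀ r' e', r' u x = σ.num 8 u x - δ → r' x u = σ.num 8 x u + δ →
      (∀ v w, ¬ (v = u ∧ w = x) → ¬ (v = x ∧ w = u) → r' v w = σ.num 8 v w) →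
      e' u = σ.num 5 0 u - δ → e' x = σ.num 5 0 x + δ →
      (∀ w, w ≠ u → w ≠ x → e' w = σ.num 5 0 w) →
      Inv N q c r' e' (σ.idx 5 0) (σ.idx 6 0) 2 ∧
        potential N r' e' (σ.idx 5 0) (σ.idx 6 0) 2 <
          potential N (σ.num 8) (σ.num 5 0) (σ.idx 5 0) (σ.idx 6 0) u :=
    fun δ h1 h2 h3 r' e' h4 h5 h6 h7 h8 h9 =>
      hinv.push huN hxN he hd hr hlt h2 h3 h1 h4 h5 h6 h7 h8 h9
  have hassemble : ∀ σ' : Store R, σ'.idx 3 0 0 = N → σ'.num 4 0 0 = τ →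
      σ'.idx 5 0 = σ.idx 5 0 → σ'.idx 6 0 = σ.idx 6 0 → σ'.idx 7 0 3 = 2 →
      (Inv N q c (σ'.num 8) (σ'.num 5 0) (σ.idx 5 0) (σ.idx 6 0) 2 ∧
        potential N (σ'.num 8) (σ'.num 5 0) (σ.idx 5 0) (σ.idx 6 0) 2 <
          potential N (σ.num 8) (σ.num 5 0) (σ.idx 5 0) (σ.idx 6 0) u) →
      State N q c τ σ' ∧ storePotential N σ' < storePotential N σ := by
    intro σ' h1 h2 h3 h4 h5 h6
    refine ⟨⟨h1, h2, ?_⟩, ?_⟩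
    · rw [h3, h4, h5]; exact h6.1
    · rw [storePotential, storePotential, h3, h4, h5, hu]; exact h6.2
  constructor
  · intro hle
    refine hassemble _ (by simp [h.size]) (by simp [h.threshold]) (by simp) (by simp) (by simp)
      (key (σ.num 5 0 u) (.inl rfl) le_rfl hle _ _ ?_ ?_ ?_ ?_ ?_ ?_)
    · simp [hux]
    · simp [hux, hux.symm]
    · intro v w h1 h2; simp [h1, h2]
    · simp [hux]
    · simp [hux.symm]
    · intro w h1 h2; simp [h1, h2]
  · intro hle
    refine hassemble _ (by simp [h.size]) (by simp [h.threshold]) (by simp) (by simp) (by simp)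
      (key (σ.num 8 u x) (.inr rfl) (not_le.1 hle).le le_rfl _ _ ?_ ?_ ?_ ?_ ?_ ?_)
    · simp [hux]
    · simp [hux, hux.symm]
    · intro v w h1 h2; simp [h1, h2]
    · simp [hux]
    · simp [hux.symm]
    · intro w h1 h2; simp [h1, h2]

theorem State.wp_stepProg {σ : Store R} (h : State N q c τ σ) (hu : σ.idx 7 0 3 < N) :
    stepProg.wp (fun σ' => State N q c τ σ' ∧ storePotential N σ' < storePotential N σ) σ := by
  -- The four branches are, in this order, `Inv.push`, `Inv.scan`, `Inv.relabel` and `Inv.next`.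
  refine ⟨fun hact => ⟨fun harc => ⟨fun hadm => ?_, fun hadm => ?_⟩, fun harc => ?_⟩,
    fun hact => ?_⟩
  all_goals simp only [excess, vertex, scalar, labelOf, order, IExpr.eval, NExpr.eval,
    Test.Holds, h.size, not_le] at hact
  all_goals try simp only [vertex, arcEnd, scalar, order, IExpr.eval, Test.Holds, h.size] at harc
  all_goals try simp only [vertex, arcEnd, scalar, labelOf, IExpr.eval, NExpr.eval, Test.Holds,
    not_le] at hadm
  · exact h.wp_pushProg rfl rfl hu harc hact.1 hact.2 hadm.1 hadm.2
  · have := h.inv.scan (p' := fun w => if w = σ.idx 7 0 3 then σ.idx 6 0 (σ.idx 7 0 3) + 1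
      else σ.idx 6 0 w) hu harc hadm (by simp) (fun w hw => by simp [hw])
    exact ⟨⟨by simp [Store.setIdx, h.size], h.threshold,
      by simpa [Store.setIdx, IExpr.eval, scalar, vertex, arcEnd] using this.1⟩,
      by simpa [storePotential, Store.setIdx, IExpr.eval, scalar, vertex, arcEnd] using this.2⟩
  · have := h.inv.relabel (d' := fun w => if w = σ.idx 7 0 3 then σ.idx 5 0 (σ.idx 7 0 3) + 1
      else σ.idx 5 0 w) (p' := fun w => if w = σ.idx 7 0 3 then 0 else σ.idx 6 0 w) hu hact.2 harc
      (by simp) (fun w hw => by simp [hw]) (by simp) (fun w hw => by simp [hw])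
    exact ⟨⟨by simp [Store.setIdx, h.size], h.threshold,
      by simpa [Store.setIdx, IExpr.eval, scalar, vertex, labelOf] using this.1⟩,
      by simpa [storePotential, Store.setIdx, IExpr.eval, scalar, vertex, labelOf] using this.2⟩
  · have := h.inv.next hu hact
    exact ⟨⟨by simp [Store.setIdx, h.size], h.threshold,
      by simpa [Store.setIdx, IExpr.eval, scalar, vertex] using this.1⟩,
      by simpa [storePotential, Store.setIdx, IExpr.eval, scalar, vertex] using this.2⟩

/-- Preflow pushing. -/
def mainLoop : Prog := .while (.lt vertex order) stepProg

theorem State.runs_mainLoop {σ : Store R} (h : State N q c τ σ) :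
    Runs mainLoop σ (((N * N + 1) ^ 5 + 1) * (7 + stepProg.time)) fun σ' =>
      State N q c τ σ' ∧ σ'.idx 7 0 3 = N := by
  refine (Runs.while (c := .lt vertex order) (μ := storePotential N) (fun σ h hc =>
    (h.wp_stepProg (by
      simpa only [vertex, scalar, order, Test.Holds, IExpr.eval, h.size] using hc)).runs)
    h).mono (Nat.mul_le_mul ?_ (le_of_eq rfl)) ?_
  · exact Nat.succ_le_succ (potential_le _ _ _ _ _ _)
  · rintro σ' ⟨h1, h2⟩
    refine ⟨h1, le_antisymm h1.inv.u_le ?_⟩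
    simpa only [vertex, scalar, order, Test.Holds, IExpr.eval, h1.size, not_lt] using h2

end Preflow

/-! ### Cuts and selections of players -/

namespace RPSP

open RAM

variable {R : Type} [AddCommGroup R] [LinearOrder R]

/-- The rewards that are lost and the penalties that are paid if `X` is selected. -/
def loss (I : RPSP R) (X : Finset (Fin I.n)) : R :=
  (∑ j with (I.B j ∩ X).Nonempty, I.b j) + ∑ i with ¬ I.A i ⊆ X, I.a i

/-- The finite part of the capacity of the cut with the penalty sets in `J` and the reward sets in
`H` on the side of the source. -/
def pairCut (I : RPSP R) (J : Finset (Fin I.l)) (H : Finset (Fin I.h)) : R :=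
  ∑ j ∈ Jᶜ, I.b j + ∑ i ∈ H, I.a i

/-- No penalty set in `J` meets a reward set outside `H`. -/
def IsClosedPair (I : RPSP R) (J : Finset (Fin I.l)) (H : Finset (Fin I.h)) : Prop :=
  ∀ j ∈ J, ∀ i ∉ H, ¬ (I.A i ∩ I.B j).Nonempty

theorem exists_pair_of_selection (I : RPSP R) (X : Finset (Fin I.n)) :
    ∃ J H, I.IsClosedPair J H ∧ I.pairCut J H = I.loss X := by
  refine ⟨Finset.univ.filter fun j => ¬ (I.B j ∩ X).Nonempty,
    Finset.univ.filter fun i => ¬ I.A i ⊆ X, ?_, ?_⟩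
  · rintro j hj i hi ⟨x, hx⟩
    simp only [Finset.mem_filter, Finset.mem_univ, true_and, not_not] at hi hj
    rw [Finset.mem_inter] at hx
    exact hj ⟨x, Finset.mem_inter.2 ⟨hx.2, hi hx.1⟩⟩
  · rw [pairCut, loss, Finset.compl_filter]
    simp only [not_not]

/-- Select every player that lies in no set of `J`. Then sets hit are outside `J`, and by closedness
reward sets outside `H` are covered. The inequality can be strict, since `Jᶜ` and `H` may be larger
than necessary. -/
theorem exists_selection_of_pair [IsOrderedAddMonoid R] (I : RPSP R) {J : Finset (Fin I.l)}
    {H : Finset (Fin I.h)} (h : I.IsClosedPair J H) : ∃ X, I.loss X ≤ I.pairCut J H := by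
  refine ⟨Finset.univ.filter fun x => ∀ j ∈ J, x ∉ I.B j, add_le_add ?_ ?_⟩
  · refine Finset.sum_le_sum_of_subset_of_nonneg ?_ fun j _ _ => I.b_nonneg j
    intro j hj
    rw [Finset.mem_compl]
    intro hjJ
    obtain ⟨x, hx⟩ := (Finset.mem_filter.1 hj).2
    rw [Finset.mem_inter, Finset.mem_filter] at hx
    exact hx.2.2 j hjJ hx.1
  · refine Finset.sum_le_sum_of_subset_of_nonneg ?_ fun i _ _ => I.a_nonneg i
    intro i hi
    by_contra hiH
    refine (Finset.mem_filter.1 hi).2 fun x hx => ?_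
    rw [Finset.mem_filter]
    exact ⟨Finset.mem_univ _, fun j hj hxj => h j hj i hiH ⟨x, Finset.mem_inter.2 ⟨hx, hxj⟩⟩⟩

theorem le_profit_iff [IsOrderedAddMonoid R] (I : RPSP R) (α : R) (X : Finset (Fin I.n)) :
    α ≤ I.profit X ↔ I.loss X ≤ I.cutThreshold α := by
  rw [profit, loss, cutThreshold, ← Finset.sum_filter_add_sum_filter_not Finset.univ
    (fun i => I.A i ⊆ X) I.a, ← sub_nonneg, ← sub_nonneg (b := _ + _)]
  apply iff_of_eq
  congr 1
  abel

/-- A form of the reduction without networks, used both for the cuts of `network` and for the finite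
capacities of the program. -/
theorem maxDecision_iff [IsOrderedAddMonoid R] (I : RPSP R) (α : R) :
    I.MaxDecision α ↔ ∃ J H, I.IsClosedPair J H ∧ I.pairCut J H ≤ I.cutThreshold α := by
  constructor
  · rintro ⟨X, hX⟩
    obtain ⟨J, H, h1, h2⟩ := I.exists_pair_of_selection X
    exact ⟨J, H, h1, h2 ▸ (I.le_profit_iff α X).1 hX⟩
  · rintro ⟨J, H, h1, h2⟩
    obtain ⟨X, hX⟩ := I.exists_selection_of_pair h1
    exact ⟨X, (I.le_profit_iff α X).2 (hX.trans h2)⟩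

/-! ### Cut capacities of the network. -/

theorem sum_rpNode {W : Type} [AddCommMonoid W] {h l : ℕ} (f : RPNode h l → W) :
    ∑ v, f v = f .source + (f .sink + (∑ j, f (.penalty j) + ∑ i, f (.reward i))) := by
  let φ : Unit ⊕ (Unit ⊕ (Fin l ⊕ Fin h)) ≃ RPNode h l :=
    { toFun := Sum.elim (fun _ => .source) (Sum.elim (fun _ => .sink)
        (Sum.elim .penalty .reward))
      invFun := fun
        | .source => .inl ()
        | .sink => .inr (.inl ())
        | .penalty j => .inr (.inr (.inl j))
        | .reward i => .inr (.inr (.inr i))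
      left_inv := by rintro (_ | _ | _ | _) <;> rfl
      right_inv := by rintro (_ | _ | _ | _) <;> rfl }
  rw [← φ.sum_comp]
  simp [φ]

/-- The arcs leaving `S` run from the source to penalty sets outside `S`, from reward sets in `S` to
the sink, or from penalty sets in `S` to reward sets outside. Only the last kind is infinite. -/
theorem cutCapacity_eq (I : RPSP R) {S : Finset (RPNode I.h I.l)} (hS : I.network.IsCut S) :
    I.network.cutCapacity S =
      (I.pairCut (Finset.univ.filter fun j => .penalty j ∈ S)
        (Finset.univ.filter fun i => .reward i ∈ S) : WithTop R) +
      ∑ j with .penalty j ∈ S, ∑ i with .reward i ∉ S,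
        if (I.A i ∩ I.B j).Nonempty then (⊤ : WithTop R) else 0 := by
  have hs : RPNode.source ∈ S := hS.1
  have ht : RPNode.sink ∉ S := hS.2
  have h1 : ∀ f : RPNode I.h I.l → WithTop R, ∑ u ∈ S, f u = f .source +
      (∑ j with .penalty j ∈ S, f (.penalty j) + ∑ i with .reward i ∈ S, f (.reward i)) := by
    intro f
    rw [← Finset.filter_univ_mem S, Finset.sum_filter, sum_rpNode]
    simp [hs, ht, Finset.sum_filter]
  have h2 : ∀ f : RPNode I.h I.l → WithTop R, ∑ u ∈ Sᶜ, f u = f .sink +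
      (∑ j with .penalty j ∉ S, f (.penalty j) + ∑ i with .reward i ∉ S, f (.reward i)) := by
    intro f
    rw [← Finset.filter_univ_mem Sᶜ, Finset.sum_filter, sum_rpNode]
    simp [hs, ht, Finset.sum_filter]
  rw [FlowNetwork.cutCapacity, h1]
  simp only [h2, network, Finset.sum_const_zero, zero_add, add_zero]
  rw [pairCut, Finset.compl_filter]
  push_cast
  abel

theorem exists_isMinCut (I : RPSP R) : ∃ S, I.network.IsMinCut S := by
  classical
  obtain ⟨S, hS, hmin⟩ := Finset.exists_min_image
    (Finset.univ.filter fun S : Finset (RPNode I.h I.l) => I.network.IsCut S)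
    I.network.cutCapacity ⟨{.source}, Finset.mem_filter.2
      ⟨Finset.mem_univ _, by simp [FlowNetwork.IsCut, network]⟩⟩
  exact ⟨S, (Finset.mem_filter.1 hS).2, fun S' hS' =>
    hmin S' (Finset.mem_filter.2 ⟨Finset.mem_univ _, hS'⟩)⟩

theorem maxDecision_iff_minCut [IsOrderedAddMonoid R] (I : RPSP R) (α : R) :
    I.MaxDecision α ↔ ∃ S : Finset (RPNode I.h I.l),
      I.network.IsMinCut S ∧ I.network.cutCapacity S ≤ (I.cutThreshold α : WithTop R) := by
  rw [maxDecision_iff]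
  constructor
  · rintro ⟨J, H, h1, h2⟩
    obtain ⟨S, hS⟩ := I.exists_isMinCut
    refine ⟨S, hS, ?_⟩
    let S' : Finset (RPNode I.h I.l) := insert .source (J.image .penalty ∪ H.image .reward)
    have hcut : I.network.IsCut S' := by simp [FlowNetwork.IsCut, network, S']
    refine (hS.2 S' hcut).trans ?_
    have hJ : (Finset.univ.filter fun j => RPNode.penalty j ∈ S') = J := by ext; simp [S']
    have hH : (Finset.univ.filter fun i => RPNode.reward i ∈ S') = H := by ext; simp [S']
    rw [I.cutCapacity_eq hcut, hJ, hH, Finset.sum_eq_zero, add_zero]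
    · exact WithTop.coe_le_coe.2 h2
    · intro j hj
      refine Finset.sum_eq_zero fun i hi => if_neg (h1 j hj i ?_)
      simpa [S'] using hi
  · rintro ⟨S, hS, hle⟩
    rw [I.cutCapacity_eq hS.1] at hle
    refine ⟨Finset.univ.filter fun j => .penalty j ∈ S,
        Finset.univ.filter fun i => .reward i ∈ S, ?_, ?_⟩
    · intro j hj i hi hne
      simp only [Finset.mem_filter, Finset.mem_univ, true_and] at hj hi
      have htop : ∑ j with .penalty j ∈ S, ∑ i with .reward i ∉ S,
          (if (I.A i ∩ I.B j).Nonempty then (⊤ : WithTop R) else 0) = ⊤ := by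
        refine WithTop.sum_eq_top.2 ⟨j, by simpa using hj,
          WithTop.sum_eq_top.2 ⟨i, by simpa using hi, if_pos hne⟩⟩
      rw [htop, WithTop.add_top] at hle
      exact absurd hle (not_le.2 (WithTop.coe_lt_top _))
    · refine WithTop.coe_le_coe.1 (le_trans ?_ hle)
      refine le_add_of_nonneg_right (Finset.sum_nonneg fun j _ => Finset.sum_nonneg fun i _ => ?_)
      split_ifs
      exacts [le_top, le_rfl]

/-! ### The arrays of the program against the network. -/

theorem input_idx_one (I : RPSP R) (α : R) (i u : ℕ) : 0 < (I.input α).idx 1 i u ↔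
    ∃ (hi : i < I.h) (hu : u < I.n), ⟨u, hu⟩ ∈ I.A ⟨i, hi⟩ := by
  simp only [input]
  split_ifs with h <;> simp [h]

theorem input_idx_two (I : RPSP R) (α : R) (j u : ℕ) : 0 < (I.input α).idx 2 j u ↔
    ∃ (hj : j < I.l) (hu : u < I.n), ⟨u, hu⟩ ∈ I.B ⟨j, hj⟩ := by
  simp only [input]
  split_ifs with h <;> simp [h]

theorem input_num_zero (I : RPSP R) (α : R) (i : Fin I.h) : (I.input α).num 0 0 i = I.a i := by
  simp [input]

theorem input_num_one (I : RPSP R) (α : R) (j : Fin I.l) : (I.input α).num 1 0 j = I.b j := by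
  simp [input]

theorem meets_iff (I : RPSP R) (α : R) (v w : ℕ) : Meets I α (triples I) v w ↔
    ∃ (j : Fin I.l) (i : Fin I.h), v = 2 + j ∧ w = 2 + I.l + i ∧ (I.A i ∩ I.B j).Nonempty := by
  constructor
  · rintro ⟨j, i, u, -, hv, hw, h1, h2⟩
    obtain ⟨hi, hu, h1⟩ := (I.input_idx_one α i u).1 h1
    obtain ⟨hj, hu, h2⟩ := (I.input_idx_two α j u).1 h2
    exact ⟨⟨j, hj⟩, ⟨i, hi⟩, hv, hw, ⟨u, hu⟩, Finset.mem_inter.2 ⟨h1, h2⟩⟩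
  · rintro ⟨j, i, hv, hw, u, hu⟩
    rw [Finset.mem_inter] at hu
    exact ⟨j, i, u, ⟨j.2, i.2, u.2⟩, hv, hw, (I.input_idx_one α i u).2 ⟨i.2, u.2, hu.1⟩,
      (I.input_idx_two α j u).2 ⟨j.2, u.2, hu.2⟩⟩

theorem meets_iff_cap_eq_top (I : RPSP R) (α : R) (u v : RPNode I.h I.l) :
    Meets I α (triples I) u.code v.code ↔ I.network.cap u v = ⊤ := by
  rw [meets_iff]
  constructor
  · rintro ⟨j, i, hu, hv, hne⟩
    have := j.2
    have := i.2
    obtain rfl : u = .penalty j := by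
      cases u <;> simp only [RPNode.code, RPNode.penalty.injEq, reduceCtorEq, Fin.ext_iff] at hu ⊢
        <;> omega
    obtain rfl : v = .reward i := by
      cases v <;> simp only [RPNode.code, RPNode.reward.injEq, reduceCtorEq, Fin.ext_iff] at hv ⊢
        <;> omega
    simp [network, hne]
  · intro h
    cases u <;> cases v <;> simp only [network, WithTop.coe_ne_top, WithTop.zero_ne_top] at h
    rename_i j i
    refine ⟨j, i, rfl, rfl, ?_⟩
    by_contra hne
    simp [hne] at h

theorem Built.holdsNetwork {I : RPSP R} {α : R} {σ : Store R}
    (h : Built I α I.h I.l (triples I) σ) : I.HoldsNetwork α σ := by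
  classical
  refine ⟨h.size, fun u v => ?_, fun u v => ?_, ?_⟩
  · rw [h.flag]
    have := I.meets_iff_cap_eq_top α u v
    split_ifs <;> tauto
  · rw [h.cap]
    have hl : ∀ j : Fin I.l, (j : ℕ) < I.l := fun j => j.2
    have hh : ∀ i : Fin I.h, (i : ℕ) < I.h := fun i => i.2
    rcases u with _ | _ | j | i <;> rcases v with _ | _ | j' | i'
    case source.penalty => simp [RPNode.code, network, input_num_one, hl]
    case reward.sink => simp [RPNode.code, network, input_num_zero, hh]
    case penalty.reward =>
      rw [if_neg (by simp only [RPNode.code]; omega), if_neg (by simp only [RPNode.code]; omega)]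
      simp only [network]
      split_ifs <;> rfl
    case penalty.sink =>
      have := hl j
      rw [if_neg (by simp only [RPNode.code]; omega), if_neg (by simp only [RPNode.code]; omega)]
      rfl
    all_goals
      rw [if_neg (by simp only [RPNode.code]; omega), if_neg (by simp only [RPNode.code]; omega)]
      rfl
  · rw [h.threshold, cutThreshold, Finset.sum_range]
    simp only [input_num_zero]

/-- At the start nothing has been pushed: residual capacities equal capacities, excesses equal
supplies, and all labels and current arcs are `0`. Vertex `0` stands for the source but is isolated,
the supplies having taken over its arcs. -/
theorem Built.state [IsOrderedAddMonoid R] {I : RPSP R} {α : R} {σ : Store R}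
    (h : Built I α I.h I.l (triples I) σ) :
    Preflow.State (I.h + I.l + 2) (σ.num 5 0) (σ.num 8) (I.cutThreshold α)
      (σ.setIdx 7 0 3 2) := by
  classical
  have h0 : ∀ i, 0 ≤ (I.input α).num 0 0 i := fun i => by
    simp only [input]; split_ifs; exacts [I.a_nonneg _, le_rfl]
  have h1 : ∀ j, 0 ≤ (I.input α).num 1 0 j := fun j => by
    simp only [input]; split_ifs; exacts [I.b_nonneg _, le_rfl]
  have hM : 0 ≤ penaltySum I α I.l := Finset.sum_nonneg fun j _ => h1 j
  refine ⟨by simpa [Store.setIdx] using h.size, h.holdsNetwork.2.2.2, ?_⟩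
  simp only [Store.setIdx, Nat.reduceEqDiff, false_and, if_false, and_self, if_true]
  exact
    { r_nonneg := fun v w => by
        rw [h.residual]; split_ifs; exacts [h0 _, hM, le_rfl]
      r_add := fun _ _ => rfl
      e_nonneg := fun w => by
        rw [h.supply]; split_ifs; exacts [h1 _, le_rfl]
      e_eq := fun w _ => by simp
      e_zero := by rw [h.supply]; simp
      r_zero := fun w => by
        rw [h.residual, if_neg (by omega), if_neg]
        rintro ⟨j, i, u, -, -, h, -⟩
        omega
      d_zero := h.label 0
      d_one := h.label 1
      valid := fun v _ w _ _ => by rw [h.label]; omega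
      p_le := fun w => by rw [h.arc]; omega
      scanned := fun v _ w _ _ => by rw [h.label]; omega
      done := fun w h2 h3 => by omega
      two_le := le_rfl
      u_le := by omega }

theorem sum_range_nodes {W : Type} [AddCommMonoid W] (h l : ℕ) (f : ℕ → W) :
    ∑ v ∈ Finset.range (h + l + 2), f v =
      f 0 + (f 1 + (∑ j : Fin l, f (2 + j) + ∑ i : Fin h, f (2 + l + i))) := by
  rw [show h + l + 2 = 2 + l + h by ring, Finset.sum_range_add, Finset.sum_range_add,
    Finset.sum_range, Finset.sum_range, Finset.sum_range, Fin.sum_univ_two]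
  simp only [Fin.val_zero, Fin.val_one, add_assoc]

/-- The finite analogue of `cutCapacity_eq`: each violated pair contributes the total penalty in
place of `∞`. -/
theorem Built.cutValue_eq {I : RPSP R} {α : R} {σ : Store R}
    (h : Built I α I.h I.l (triples I) σ) {S : Finset ℕ}
    (hS : S ⊆ Finset.range (I.h + I.l + 2)) (h1 : 1 ∉ S) :
    Preflow.cutValue (I.h + I.l + 2) (σ.num 5 0) (σ.num 8) S =
      I.pairCut (Finset.univ.filter fun j => 2 + (j : ℕ) ∈ S)
        (Finset.univ.filter fun i => 2 + I.l + (i : ℕ) ∈ S) +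
      ∑ i ∈ Finset.univ.filter (fun i : Fin I.h => 2 + I.l + (i : ℕ) ∉ S),
        ∑ j ∈ Finset.univ.filter (fun j : Fin I.l => 2 + (j : ℕ) ∈ S),
        if (I.A i ∩ I.B j).Nonempty then penaltySum I α I.l else 0 := by
  classical
  have hq0 : σ.num 5 0 0 = 0 := by rw [h.supply]; simp
  have hq1 : σ.num 5 0 1 = 0 := by rw [h.supply]; simp
  have hqj : ∀ j : Fin I.l, σ.num 5 0 (2 + j) = I.b j := fun j => by
    rw [h.supply]; simp [input_num_one]
  have hqi : ∀ i : Fin I.h, σ.num 5 0 (2 + I.l + i) = 0 := fun i => by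
    rw [h.supply, if_neg (by omega)]
  have hc : ∀ v w, σ.num 8 v w = if w = 1 ∧ 2 + I.l ≤ v ∧ v < 2 + I.l + I.h then
      (I.input α).num 0 0 (v - (2 + I.l)) else if ∃ (j : Fin I.l) (i : Fin I.h),
        v = 2 + j ∧ w = 2 + I.l + i ∧ (I.A i ∩ I.B j).Nonempty then penaltySum I α I.l else 0 := by
    intro v w
    rw [h.residual]
    have := I.meets_iff α v w
    split_ifs <;> first | rfl | exact absurd (this.1 ‹_›) ‹_› | exact absurd (this.2 ‹_›) ‹_›
  have hzero : ∀ v w, ¬ (w = 1 ∧ 2 + I.l ≤ v) → ¬ (v < 2 + I.l ∧ 2 + I.l ≤ w ∧ 2 ≤ v) →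
      σ.num 8 v w = 0 := by
    intro v w h1 h2
    rw [hc, if_neg (by omega), if_neg]
    rintro ⟨j, i, hv, hw, -⟩
    have := j.2
    omega
  have hcit : ∀ i : Fin I.h, σ.num 8 (2 + I.l + i) 1 = I.a i := fun i => by
    rw [hc]; simp [input_num_zero]
  have hcji : ∀ (j : Fin I.l) (i : Fin I.h), σ.num 8 (2 + j) (2 + I.l + i) =
      if (I.A i ∩ I.B j).Nonempty then penaltySum I α I.l else 0 := fun j i => by
    rw [hc, if_neg (by omega)]
    refine if_congr ⟨?_, fun hne => ⟨j, i, rfl, rfl, hne⟩⟩ rfl rfl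
    rintro ⟨j', i', hj, hi, hne⟩
    obtain rfl : j = j' := Fin.ext (by omega)
    obtain rfl : i = i' := Fin.ext (by omega)
    exact hne
  have hc0 : ∀ w, σ.num 8 0 w = 0 := fun w => hzero _ _ (by omega) (by omega)
  have hc1 : ∀ w, σ.num 8 1 w = 0 := fun w => hzero _ _ (by omega) (by omega)
  have hcs : ∀ v, σ.num 8 v 0 = 0 := fun w => hzero _ _ (by omega) (by omega)
  have hcjt : ∀ j : Fin I.l, σ.num 8 (2 + j) 1 = 0 := fun j => hzero _ _ (by omega) (by omega)
  have hcj : ∀ (v : ℕ) (j : Fin I.l), σ.num 8 v (2 + j) = 0 := fun v j =>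
    hzero _ _ (by omega) (by omega)
  have hcii : ∀ i i' : Fin I.h, σ.num 8 (2 + I.l + i) (2 + I.l + i') = 0 := fun i i' =>
    hzero _ _ (by omega) (by omega)
  have hsum : ∀ f : ℕ → R, ∑ v ∈ S, f v =
      ∑ v ∈ Finset.range (I.h + I.l + 2), if v ∈ S then f v else 0 := by
    intro f
    rw [← Finset.sum_filter, Finset.filter_mem_eq_inter, Finset.inter_eq_right.2 hS]
  rw [Preflow.cutValue, Finset.sdiff_eq_filter, Finset.sum_filter, sum_range_nodes]
  simp only [hsum, sum_range_nodes, hq0, hq1, hqj, hqi, hc0, hc1, hcs, hcjt, hcj, hcii, hcit, hcji,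
    ite_self, zero_add, add_zero, Finset.sum_const_zero, h1, not_false_eq_true, if_true]
  rw [pairCut, Finset.compl_filter]
  simp only [Finset.sum_filter]
  abel

/-- A closed pair bounds the excess of the sink from above by weak duality. Conversely, the cut of
`Inv.exists_cut` is a closed pair or contains an arc whose capacity is the total penalty. -/
theorem Built.maxDecision_iff [IsOrderedAddMonoid R] {I : RPSP R} {α : R} {σ σ' : Store R}
    (h : Built I α I.h I.l (triples I) σ)
    (h' : Preflow.State (I.h + I.l + 2) (σ.num 5 0) (σ.num 8) (I.cutThreshold α) σ')
    (hu : σ'.idx 7 0 3 = I.h + I.l + 2) :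
    I.MaxDecision α ↔ σ'.num 5 0 1 ≤ σ'.num 4 0 0 := by
  classical
  have hinv := h'.inv
  rw [hu] at hinv
  rw [h'.threshold, RPSP.maxDecision_iff]
  constructor
  · rintro ⟨J, H, h1, h2⟩
    refine le_trans ?_ h2
    let S : Finset ℕ := J.image (fun j : Fin I.l => 2 + (j : ℕ)) ∪
      H.image (fun i : Fin I.h => 2 + I.l + (i : ℕ))
    have hS : S ⊆ Finset.range (I.h + I.l + 2) := by
      intro v hv
      simp only [S, Finset.mem_union, Finset.mem_image] at hv
      rw [Finset.mem_range]
      rcases hv with ⟨j, -, rfl⟩ | ⟨i, -, rfl⟩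
      · have := j.2; omega
      · have := i.2; omega
    have h1S : 1 ∉ S := by
      simp only [S, Finset.mem_union, Finset.mem_image]
      rintro (⟨j, -, h⟩ | ⟨i, -, h⟩) <;> omega
    have hJ : (Finset.univ.filter fun j : Fin I.l => 2 + (j : ℕ) ∈ S) = J := by
      ext j
      simp only [S, Finset.mem_filter, Finset.mem_univ, true_and, Finset.mem_union,
        Finset.mem_image]
      constructor
      · rintro (⟨j', hj', h⟩ | ⟨i, -, h⟩)
        · obtain rfl : j' = j := Fin.ext (by omega)
          exact hj'
        · have := j.2; omega
      · exact fun hj => .inl ⟨j, hj, rfl⟩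
    have hH : (Finset.univ.filter fun i : Fin I.h => 2 + I.l + (i : ℕ) ∈ S) = H := by
      ext i
      simp only [S, Finset.mem_filter, Finset.mem_univ, true_and, Finset.mem_union,
        Finset.mem_image]
      constructor
      · rintro (⟨j, -, h⟩ | ⟨i', hi', h⟩)
        · have := j.2; omega
        · obtain rfl : i' = i := Fin.ext (by omega)
          exact hi'
      · exact fun hi => .inr ⟨i, hi, rfl⟩
    refine (hinv.excess_le (by omega) hS h1S).trans (le_of_eq ?_)
    rw [h.cutValue_eq hS h1S, hJ, hH, Finset.sum_eq_zero, add_zero]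
    intro i hi
    refine Finset.sum_eq_zero fun j hj => if_neg (h1 j hj i fun hiH => ?_)
    rw [← hH] at hiH
    exact (Finset.mem_filter.1 hi).2 (Finset.mem_filter.1 hiH).2
  · intro hle
    obtain ⟨S, hS, h1S, hcut⟩ := hinv.exists_cut
    rw [h.cutValue_eq hS h1S] at hcut
    set J := Finset.univ.filter fun j : Fin I.l => 2 + (j : ℕ) ∈ S with hJ
    set H := Finset.univ.filter fun i : Fin I.h => 2 + I.l + (i : ℕ) ∈ S with hH
    have hM : penaltySum I α I.l = ∑ j, I.b j := by
      rw [penaltySum, Finset.sum_range]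
      simp only [input_num_one]
    have hM0 : 0 ≤ penaltySum I α I.l := hM ▸ Finset.sum_nonneg fun j _ => I.b_nonneg j
    have hnn : ∀ (i : Fin I.h) (j : Fin I.l),
        0 ≤ if (I.A i ∩ I.B j).Nonempty then penaltySum I α I.l else 0 := fun i j => by
      split_ifs; exacts [hM0, le_rfl]
    by_cases hcl : I.IsClosedPair J H
    · refine ⟨J, H, hcl, le_trans ?_ hle⟩
      rw [← hcut]
      exact le_add_of_nonneg_right (Finset.sum_nonneg fun i _ => Finset.sum_nonneg fun j _ =>
        hnn i j)
    · simp only [IsClosedPair, not_forall, not_not] at hcl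
      obtain ⟨j, hj, i, hi, hne⟩ := hcl
      -- The empty pair cuts all source arcs and costs exactly the total penalty, so it is no dearer
      -- than a cut with a violated pair. This is why the total penalty may replace `∞`.
      refine ⟨∅, ∅, by simp [IsClosedPair], le_trans ?_ hle⟩
      rw [← hcut, pairCut, Finset.compl_empty, Finset.sum_empty, add_zero, ← hM]
      refine le_trans ?_ (le_add_of_nonneg_left (add_nonneg
        (Finset.sum_nonneg fun j _ => I.b_nonneg j) (Finset.sum_nonneg fun i _ => I.a_nonneg i)))
      have hi' : i ∈ Finset.univ.filter fun i : Fin I.h => 2 + I.l + (i : ℕ) ∉ S := by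
        simpa [hH] using hi
      refine le_trans ?_ (Finset.single_le_sum
        (fun i _ => Finset.sum_nonneg fun j _ => hnn i j) hi')
      refine le_trans ?_ (Finset.single_le_sum (fun j _ => hnn i j) hj)
      rw [if_pos hne]

/-! ### The decision program and its polynomial running time. -/

/-- The program that decides the max-RPSP. -/
def decideProg : Prog :=
  .seq buildProg (.seq (.setIdx 7 (.lit 0) (.lit 3) (.lit 2))
    (.seq Preflow.mainLoop
      (.ite (.le (.cell 5 (.lit 0) (.lit 1)) (.cell 4 (.lit 0) (.lit 0)))
        (.setIdx 3 (.lit 0) (.lit 0) (.lit 1)) (.setIdx 3 (.lit 0) (.lit 0) (.lit 0)))))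

/-- The number of steps of `decideProg`. -/
def decideTime (n h l : ℕ) : ℕ :=
  buildTime n h l + (4 + ((((h + l + 2) * (h + l + 2) + 1) ^ 5 + 1) *
    (7 + Preflow.stepProg.time) + 15))

theorem runs_decideProg [IsOrderedAddMonoid R] (I : RPSP R) (α : R) :
    Runs decideProg (I.input α) (decideTime I.n I.h I.l) fun σ =>
      (I.MaxDecision α → σ.idx 3 0 0 = 1) ∧ (¬ I.MaxDecision α → σ.idx 3 0 0 = 0) := by
  refine Runs.seq ((runs_buildProg I α).mono le_rfl fun σ hσ => Runs.seq ?_)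
  refine Prog.wp.runs (P := .setIdx 7 (.lit 0) (.lit 3) (.lit 2)) (Runs.seq ?_)
  refine hσ.state.runs_mainLoop.mono le_rfl fun σ' h' => ?_
  refine (Prog.wp.runs ?_).mono (by decide) fun _ h => h
  have hiff := hσ.maxDecision_iff h'.1 h'.2
  constructor
  · intro hle
    refine ⟨fun _ => by simp [Store.setIdx, IExpr.eval], fun hno => absurd (hiff.2 hle) hno⟩
  · intro hle
    refine ⟨fun hyes => absurd (hiff.1 hyes) hle, fun _ => by simp [Store.setIdx, IExpr.eval]⟩

open Polynomial in
theorem exists_polynomial_buildTime : ∃ p : ℕ[X], ∀ x, p.eval x = buildTime x x x := by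
  refine ⟨21 + ((X + 1) * (C penaltyStep.time + 19) + ((X + 1) * (C rewardStep.time + 19) +
    (X + 1) * ((X + 1) * ((X + 1) * (C arcStep.time + 19) + 19) + 19))), fun x => ?_⟩
  simp only [eval_add, eval_mul, eval_X, eval_C, eval_one, eval_ofNat, buildTime]

open Polynomial in
theorem exists_polynomial_decideTime : ∃ p : ℕ[X], ∀ x, p.eval x = decideTime x x x := by
  obtain ⟨p, hp⟩ := exists_polynomial_buildTime
  refine ⟨p + (4 + ((((X + X + 2) * (X + X + 2) + 1) ^ 5 + 1) *
    (7 + C Preflow.stepProg.time) + 15)), fun x => ?_⟩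
  simp only [eval_add, eval_mul, eval_pow, eval_X, eval_C, eval_one, eval_ofNat, decideTime, hp]

theorem buildTime_mono {n h l x : ℕ} (hn : n ≤ x) (hh : h ≤ x) (hl : l ≤ x) :
    buildTime n h l ≤ buildTime x x x := by
  unfold buildTime
  gcongr

theorem decideTime_mono {n h l x : ℕ} (hn : n ≤ x) (hh : h ≤ x) (hl : l ≤ x) :
    decideTime n h l ≤ decideTime x x x := by
  unfold decideTime
  have := buildTime_mono hn hh hl
  gcongr

theorem networkBuiltInPolyTime_unitCost (R : Type) [AddCommGroup R] [LinearOrder R] :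
    NetworkBuiltInPolyTime (unitCost R) buildProg := by
  obtain ⟨p, hp⟩ := exists_polynomial_buildTime
  refine ⟨p, fun I α => ?_⟩
  obtain ⟨T, σ, h1, h2, h3⟩ := runs_buildProg I α
  refine ⟨T, σ, h1, h2.trans ?_, h3.holdsNetwork⟩
  rw [hp]
  -- The polynomial has one variable, the input size, which dominates each of `n`, `h` and `l`.
  apply buildTime_mono <;> unfold inputSize <;> omega

theorem decidedInPolyTime_unitCost (R : Type) [AddCommGroup R] [LinearOrder R]
    [IsOrderedAddMonoid R] : DecidedInPolyTime (unitCost R) decideProg := by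
  obtain ⟨p, hp⟩ := exists_polynomial_decideTime
  refine ⟨p, fun I α => ?_⟩
  obtain ⟨T, σ, h1, h2, h3⟩ := runs_decideProg I α
  refine ⟨T, σ, h1, h2.trans ?_, h3⟩
  rw [hp]
  apply decideTime_mono <;> unfold inputSize <;> omega

end RPSP

theorem mainTheorem2 :
    -- the answer is read off from one minimum cut of the network
    (∀ (I : RPSP ℝ) (α : ℝ),
      I.MaxDecision α ↔
        ∃ S : Finset (RPNode I.h I.l),
          I.network.IsMinCut S ∧ I.network.cutCapacity S ≤ (I.cutThreshold α : WithTop ℝ)) ∧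
    -- network and threshold are computable in polynomial time
    (∃ P : RAM.Prog,
      RPSP.NetworkBuiltInPolyTime (RAM.unitCost ℝ) P ∧
        RPSP.NetworkBuiltInPolyTime RAM.bitCost P) ∧
    -- the decision problem is solvable in polynomial time
    (∃ P : RAM.Prog,
      RPSP.DecidedInPolyTime (RAM.unitCost ℝ) P ∧
        RPSP.DecidedInPolyTime RAM.bitCost P) :=
  ⟨fun I α => I.maxDecision_iff_minCut α,
    -- The same program serves both cost models: its step bound over `ℚ` yields the bit bound.
    ⟨RPSP.buildProg, RPSP.networkBuiltInPolyTime_unitCost ℝ,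
      RPSP.bitCost_of_unitCost (RPSP.networkBuiltInPolyTime_unitCost ℚ)⟩,
    ⟨RPSP.decideProg, RPSP.decidedInPolyTime_unitCost ℝ,
      RPSP.bitCost_of_unitCost (RPSP.decidedInPolyTime_unitCost ℚ)⟩⟩
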